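/- **Theorem 2.5.** *Conventions.* An extended metric on a set $X$ is a metric $d:X\times X\to[0,\infty]$ that may have at most one infinitely remote point $\omega$, i.e. $d(\omega,\omega)=0$, $d(x,\omega)=\infty$ for $x\ne\omega$; all other distances are finite. A quadruple of points is admissible if no entry occurs three or four times in it; its cross-ratio triple is $$\mathrm{crt}_d(x,y,z,u)=(d(x,y)d(z,u):d(x,z)d(y,u):d(x,u)d(y,z))\in\mathbb{R}P^2,$$ where infinite factors are cancelled, so that $\mathrm{crt}_d(x,y,z,\infty)=(d(x,y):d(x,z):d(y,z))$ and $\mathrm{crt}_d(x,y,\infty,\infty)=(0:1:1)$. A Möbius structure on $X$ is a full (nonempty) class of extended metrics with the same cross-ratio triples on admissible quadruples. It defines a topology on $X$, whose basis consists, for any metric of the structure, of the open balls around points that are not infinitely remote and of the complements of closed balls around such points. $X$ is a Ptolemy space if the entries of the cross-ratio triple of every admissible quadruple satisfy the triangle inequality. A Möbius automorphism is a bijection $X\to X$ that preserves the cross-ratio triples of admissible quadruples. For $\omega\in X$ put $X_\omega=X\setminus\{\omega\}$, with a metric of the Möbius structure for which $\omega$ is infinitely remote (in a Ptolemy space such a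 metric exists, and it is unique up to a positive factor). A Ptolemy circle is a subset $\sigma\subset X$ homeomorphic to $S^1$ such that $d(x,z)d(y,u)=d(x,y)d(z,u)+d(x,u)d(y,z)$ (infinite factors being cancelled) for all distinct $x,y,z,u\in\sigma$ for which $y$ and $u$ lie in different components of $\sigma\setminus\{x,z\}$, where $d$ is any metric of the structure. A Ptolemy line in $X_\omega$ is a set $\sigma\setminus\{\omega\}$, where $\sigma$ is a Ptolemy circle through $\omega$. A sphere between distinct points $\omega,\omega'$ is an equivalence class in $X\setminus\{\omega,\omega'\}$ of the relation that the first two entries of $\mathrm{crt}(\omega,x,y,\omega')$ are equal. A space inversion with respect to $\omega,\omega'$ and a sphere $S$ between them is a Möbius automorphism $\phi$ with $\phi^2=\mathrm{id}$, without fixed points, such that $\phi(\omega)=\omega'$, $\phi(S)=S$, and $\phi(\sigma)=\sigma$ for every Ptolemy circle $\sigma$ through $\omega$ and $\omega'$. *Statement.* Let $X$ be a compact Ptolemy space such that (E) there is at least one Ptolemy circle in $X$; (I) for all distinct $\omega,\omega'\in X$ and every sphere $S\subset X$ between $\omega,\omega'$ there is a unique space inversion with respect to $\omega,\omega'$ and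 $S$. Then every $\omega\in X$ is infinitely remote for some metric of the Möbius structure and, whichever such metrics are chosen on the spaces $X_\omega$, there are metric spaces $B_\omega$ and maps $\pi_\omega:X_\omega\to B_\omega$ ($\omega\in X$) with the following properties. 1. For every $\omega\in X$ the space $B_\omega$ is isometric to a Euclidean space $\mathbb{R}^k$, $k\ge1$, and $\pi_\omega$ is a 1-Lipschitz submetry, i.e. it is 1-Lipschitz and the image of every ball $B_r(x)\subset X_\omega$, $r>0$, is the ball $B_r(\pi_\omega(x))\subset B_\omega$. 2. Every Möbius automorphism $\phi:X\to X$ with $\phi(\omega)=\omega'$ induces a homothety $\overline\phi:B_\omega\to B_{\omega'}$ with $\pi_{\omega'}\circ\phi=\overline\phi\circ\pi_\omega$ on $X_\omega$. 3. The fibers of $\pi_\omega$ (called $\mathbb{K}$-lines) have the property ($\mathbb{K}$): given a $\mathbb{K}$-line $F\subset X_\omega$ and $x\in X_\omega\setminus F$, there is a unique Ptolemy line $l\subset X_\omega$ through $x$ that intersects $F$. -/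

import Mathlib

open scoped ENNReal

universe u

namespace MoebiusGeometry

/-- An extended metric on `X`: a metric with values in `[0, ∞]` with at most one infinitely remote
point. A distance is infinite exactly when the two points are distinct and one of them is the
infinitely remote point. -/
structure ExtMetric (X : Type u) where
  /-- the distance function -/
  dist : X → X → ℝ≥0∞
  /-- the infinitely remote point, if there is one -/
  remote : Option X
  dist_self : ∀ x, dist x x = 0
  eq_of_dist_eq_zero : ∀ x y, dist x y = 0 → x = y
  dist_comm : ∀ x y, dist x y = dist y x
  dist_triangle : ∀ x y z, dist x z ≤ dist x y + dist y z
  dist_eq_top_iff : ∀ x y, dist x y = ∞ ↔ x ≠ y ∧ (remote = some x ∨ remote = some y)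

/-- A quadruple is admissible if no entry occurs three or four times in it. -/
def Admissible {X : Type u} (x y z w : X) : Prop :=
  ¬(x = y ∧ y = z) ∧ ¬(x = y ∧ y = w) ∧ ¬(x = z ∧ z = w) ∧ ¬(y = z ∧ z = w)

/-- Equality of the points of the real projective plane with homogeneous coordinates `a`, `b`
(used for nonzero triples). -/
def SameRatio (a b : Fin 3 → ℝ) : Prop :=
  ∃ c : ℝ, c ≠ 0 ∧ a = c • b

namespace ExtMetric

variable {X : Type u} (d : ExtMetric X)

/-- The real number by which a distance enters the homogeneous coordinates of a cross-ratio triple: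
infinite distances are replaced by `1`. If the infinitely remote point occurs once in a quadruple,
this cancels the common factor `∞`; if it occurs twice, it gives `(0 : 1 : 1)` up to order. -/
noncomputable def factor (x y : X) : ℝ :=
  if d.dist x y = ∞ then 1 else (d.dist x y).toReal

/-- Homogeneous coordinates of the cross-ratio triple
`(d(x,y)d(z,w) : d(x,z)d(y,w) : d(x,w)d(y,z))`. -/
noncomputable def crt (x y z w : X) : Fin 3 → ℝ :=
  ![d.factor x y * d.factor z w, d.factor x z * d.factor y w, d.factor x w * d.factor y z]

theorem factor_eq_zero_iff (x y : X) : d.factor x y = 0 ↔ x = y := by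
  unfold factor
  constructor
  · intro h
    split_ifs at h with h1
    · exact absurd h one_ne_zero
    · rcases (ENNReal.toReal_eq_zero_iff _).1 h with h2 | h2
      · exact d.eq_of_dist_eq_zero x y h2
      · exact absurd h2 h1
  · rintro rfl
    simp [d.dist_self]

/-- The homogeneous coordinates of an admissible quadruple are not all zero, so they do define a
point of the projective plane. -/
theorem crt_ne_zero {x y z w : X} (h : Admissible x y z w) : d.crt x y z w ≠ 0 := by
  intro h0
  have h1 := congrFun h0 0
  have h2 := congrFun h0 1
  have h3 := congrFun h0 2
  simp only [crt, Matrix.cons_val, Pi.zero_apply, mul_eq_zero, factor_eq_zero_iff] at h1 h2 h3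
  obtain ⟨k1, k2, k3, k4⟩ := h
  grind

/-- Two extended metrics are Moebius equivalent if they have the same cross-ratio triples. -/
def MoebiusEquiv (d₁ d₂ : ExtMetric X) : Prop :=
  ∀ x y z w : X, Admissible x y z w → SameRatio (d₁.crt x y z w) (d₂.crt x y z w)

/-- The topology of an extended metric: generated by the open balls around the points that are not
infinitely remote, and by the complements of the closed balls around such points. -/
@[reducible] def topology : TopologicalSpace X :=
  TopologicalSpace.generateFrom
    ({U | ∃ (x : X) (r : ℝ), d.remote ≠ some x ∧ U = {y | d.dist y x < ENNReal.ofReal r}} ∪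
      {U | ∃ (x : X) (r : ℝ), d.remote ≠ some x ∧ U = {y | d.dist y x ≤ ENNReal.ofReal r}ᶜ})

end ExtMetric

/-- A Moebius structure on `X`: a nonempty full class of Moebius equivalent extended metrics. -/
structure MoebiusStructure (X : Type u) where
  metrics : Set (ExtMetric X)
  nonempty : metrics.Nonempty
  mem_iff : ∀ d ∈ metrics, ∀ e : ExtMetric X, e ∈ metrics ↔ d.MoebiusEquiv e

/-- The set `X` without the point `ω`. -/
abbrev Punctured (X : Type u) (ω : X) : Type u := {x : X // x ≠ ω}

namespace MoebiusStructure

variable {X : Type u} (M : MoebiusStructure X)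

/-- The topology of a Moebius space is the topology of some (equivalently, any) metric of its
Moebius structure. -/
@[reducible] noncomputable def topology : TopologicalSpace X :=
  M.nonempty.some.topology

/-- The Ptolemy property: the entries of every cross-ratio triple satisfy the triangle
inequality. -/
def IsPtolemy : Prop :=
  ∀ d ∈ M.metrics, ∀ x y z w : X, Admissible x y z w →
    d.crt x y z w 0 ≤ d.crt x y z w 1 + d.crt x y z w 2 ∧
    d.crt x y z w 1 ≤ d.crt x y z w 0 + d.crt x y z w 2 ∧
    d.crt x y z w 2 ≤ d.crt x y z w 0 + d.crt x y z w 1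

/-- A Moebius automorphism: a bijection that preserves the cross-ratio triples. -/
structure IsAut (φ : X → X) : Prop where
  bijective : Function.Bijective φ
  crt_eq : ∀ d ∈ M.metrics, ∀ x y z w : X, Admissible x y z w →
    SameRatio (d.crt (φ x) (φ y) (φ z) (φ w)) (d.crt x y z w)

/-- `S` is a sphere between `ω` and `ω'`: an equivalence class, in `X` without `ω` and `ω'`, of the
relation that the first two entries of the cross-ratio triple of `(ω, x, y, ω')` are equal. -/
def IsSphere (ω ω' : X) (S : Set X) : Prop :=
  ∃ x : X, x ≠ ω ∧ x ≠ ω' ∧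
    S = {y | y ≠ ω ∧ y ≠ ω' ∧ ∀ d ∈ M.metrics, d.crt ω x y ω' 0 = d.crt ω x y ω' 1}

/-- A Ptolemy circle: a subset homeomorphic to the circle such that the Ptolemy equality holds for
all distinct points `x, y, z, w` of it for which `y` and `w` lie in different components of the
complement of `{x, z}` in it. -/
structure IsPtolemyCircle (σ : Set X) : Prop where
  homeomorphic : letI := M.topology; Nonempty (σ ≃ₜ Circle)
  ptolemy_eq : letI := M.topology
    ∀ x ∈ σ, ∀ y ∈ σ, ∀ z ∈ σ, ∀ w ∈ σ,
      x ≠ y → x ≠ z → x ≠ w → y ≠ z → y ≠ w → z ≠ w →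
      connectedComponentIn (σ \ {x, z}) y ≠ connectedComponentIn (σ \ {x, z}) w →
      ∀ d ∈ M.metrics, d.factor x z * d.factor y w =
        d.factor x y * d.factor z w + d.factor x w * d.factor y z

/-- A Ptolemy line in `X` without `ω`: a Ptolemy circle through `ω` with the point `ω` removed. -/
def IsPtolemyLine (ω : X) (l : Set (Punctured X ω)) : Prop :=
  ∃ σ : Set X, M.IsPtolemyCircle σ ∧ ω ∈ σ ∧ l = Subtype.val ⁻¹' σ

/-- A space inversion with respect to `ω`, `ω'` and a sphere `S` between them. -/
structure IsSpaceInversion (ω ω' : X) (S : Set X) (φ : X → X) : Prop where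
  isAut : M.IsAut φ
  involutive : Function.Involutive φ
  fixedPointFree : ∀ x, φ x ≠ x
  map_base : φ ω = ω'
  map_sphere : φ '' S = S
  map_circle : ∀ σ : Set X, M.IsPtolemyCircle σ → ω ∈ σ → ω' ∈ σ → φ '' σ = σ

/-- Property (E): there is at least one Ptolemy circle. -/
def PropertyE : Prop :=
  ∃ σ : Set X, M.IsPtolemyCircle σ

/-- Property (I): for all distinct points and every sphere between them there is a unique space
inversion. -/
def PropertyI : Prop :=
  ∀ ω ω' : X, ω ≠ ω' → ∀ S : Set X, M.IsSphere ω ω' S → ∃! φ : X → X, M.IsSpaceInversion ω ω' S φ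

end MoebiusStructure

/-- A submetry from `(Y, d)`: it maps every ball onto the ball of the same radius around the image
of the center. -/
def IsSubmetry {Y B : Type u} [MetricSpace B] (d : Y → Y → ℝ≥0∞) (f : Y → B) : Prop :=
  ∀ (x : Y) (r : ℝ), 0 < r → f '' {y | d y x < ENNReal.ofReal r} = Metric.ball (f x) r

/-- A 1-Lipschitz map from `(Y, d)`. -/
def IsOneLipschitz {Y B : Type u} [MetricSpace B] (d : Y → Y → ℝ≥0∞) (f : Y → B) : Prop :=
  ∀ x y : Y, edist (f x) (f y) ≤ d x y

end MoebiusGeometry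

open MoebiusGeometry

/-! Send `ω` to infinity. In `X_ω` the Ptolemy circles through `ω` become exactly the geodesic
lines, a space inversion with respect to `ω` and `o` becomes a metric inversion centred at `o` that
reverses every line through `o`, and compactness of `X` makes `X_ω` proper. The metric part of the
argument uses only this and the Ptolemy inequality (`InversiveSpace`). Two inversions with the same
centre compose to a homothety, so homotheties of every ratio exist at every point, and limits of
their compositions replace translations.

The base is built from Busemann functions. The Ptolemy inequality makes them concave along lines.
The crucial fact is that the two Busemann functions of a line are opposite (`busemann_neg`): an
inversion turns their sum into a rescaled second difference of the distance to the points of the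
line, and this vanishes in the limit wherever that Lipschitz function is differentiable. Hence
Busemann functions are affine along lines.

Homotheties and translations act affinely on the vector `busemannMap y` of all Busemann values, so
the differences of these vectors form a vector space. A nearest-point argument realizes each nonzero
difference by a segment of a line (`exists_line_of_busemannMap_ne`), whose length serves as the
norm. The norm comes from an inner product because the slope of the Busemann function of one line
along another is symmetric (`busemann_slope_comm`), and properness forces finite dimension. The map
to this Euclidean space is `π_ω`.

The base distance is the largest difference of Busemann values. This description is respected by
similarities, hence by Moebius automorphisms. Uniqueness in property (K) holds because two lines
from a point to one fiber reach it at equal parameters, so one has slope one for the Busemann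
function of the other, and gluing half-lines then identifies them (`line_eq_of_busemann`). -/

namespace MoebiusGeometry

open Filter Topology

/-! ### Busemann functions of geodesic lines. -/

section Busemann

variable {Y : Type*} [MetricSpace Y] {c e : ℝ → Y}

/-- The Busemann function of a geodesic line, normalized so that it increases along the line. -/
noncomputable def busemann (c : ℝ → Y) (y : Y) : ℝ := ⨆ t : ℝ, (t - dist y (c t))

theorem sub_dist_monotone (hc : Isometry c) (y : Y) :
    Monotone fun t : ℝ => t - dist y (c t) := by
  intro s t hst
  have h1 := dist_triangle y (c s) (c t)
  rw [hc.dist_eq, Real.dist_eq, abs_sub_comm, abs_of_nonneg (by linarith)] at h1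
  simp only
  linarith

theorem sub_dist_le (hc : Isometry c) (y : Y) (t s : ℝ) :
    t - dist y (c t) ≤ s + dist y (c s) := by
  have h1 := dist_triangle_left (c t) (c s) y
  rw [hc.dist_eq, Real.dist_eq] at h1
  have := le_abs_self (t - s)
  linarith

theorem bddAbove_sub_dist (hc : Isometry c) (y : Y) :
    BddAbove (Set.range fun t : ℝ => t - dist y (c t)) :=
  ⟨0 + dist y (c 0), by rintro _ ⟨t, rfl⟩; exact sub_dist_le hc y t 0⟩

theorem le_busemann (hc : Isometry c) (y : Y) (t : ℝ) : t - dist y (c t) ≤ busemann c y :=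
  le_ciSup (bddAbove_sub_dist hc y) t

theorem busemann_le (hc : Isometry c) (y : Y) (s : ℝ) : busemann c y ≤ s + dist y (c s) :=
  ciSup_le fun t => sub_dist_le hc y t s

theorem tendsto_busemann (hc : Isometry c) (y : Y) :
    Tendsto (fun t : ℝ => t - dist y (c t)) atTop (𝓝 (busemann c y)) :=
  tendsto_atTop_ciSup (sub_dist_monotone hc y) (bddAbove_sub_dist hc y)

theorem tendsto_busemann_nat (hc : Isometry c) (y : Y) :
    Tendsto (fun n : ℕ => (n : ℝ) - dist y (c n)) (hyperfilter ℕ) (𝓝 (busemann c y)) :=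
  (tendsto_busemann hc y).comp
    (tendsto_natCast_atTop_atTop.mono_left Nat.hyperfilter_le_atTop)

theorem busemann_sub_le (hc : Isometry c) (x y : Y) :
    busemann c x - busemann c y ≤ dist x y := by
  have : busemann c x ≤ busemann c y + dist x y := ciSup_le fun t => by
    have h1 := le_busemann hc y t
    have h2 := dist_triangle_left y (c t) x
    linarith
  linarith

theorem abs_busemann_sub_le (hc : Isometry c) (x y : Y) :
    |busemann c x - busemann c y| ≤ dist x y := by
  rw [abs_le]
  have h1 := busemann_sub_le hc x y
  have h2 := busemann_sub_le hc y x
  rw [dist_comm] at h2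
  constructor <;> linarith

theorem continuous_busemann (hc : Isometry c) : Continuous (busemann c) :=
  (LipschitzWith.of_dist_le_mul (K := 1) fun x y => by
    simpa [Real.dist_eq] using abs_busemann_sub_le hc x y).continuous

theorem busemann_line (hc : Isometry c) (t : ℝ) : busemann c (c t) = t := by
  have h1 := le_busemann hc (c t) t
  have h2 := busemann_le hc (c t) t
  rw [dist_self] at h1 h2
  linarith

theorem isometry_comp_add (hc : Isometry c) (s : ℝ) : Isometry fun t => c (t + s) :=
  Isometry.of_dist_eq fun a b => by simp [hc.dist_eq]

theorem isometry_comp_neg (hc : Isometry c) : Isometry fun t => c (-t) :=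
  Isometry.of_dist_eq fun a b => by simp [hc.dist_eq]

/-- A similarity with ratio `l` carries lines to lines and Busemann functions to multiples of
Busemann functions. -/
theorem isometry_similarity {Y' : Type*} [MetricSpace Y'] {h : Y → Y'} {l : ℝ} (hl : 0 < l)
    (hd : ∀ x y, dist (h x) (h y) = l * dist x y) (hc : Isometry c) :
    Isometry fun t => h (c (t / l)) :=
  Isometry.of_dist_eq fun a b => by
    rw [hd, hc.dist_eq, Real.dist_eq, Real.dist_eq, ← sub_div, abs_div, abs_of_pos hl]
    field_simp

theorem busemann_similarity {Y' : Type*} [MetricSpace Y'] {h : Y → Y'} {l : ℝ} (hl : 0 < l)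
    (hd : ∀ x y, dist (h x) (h y) = l * dist x y) (hc : Isometry c) (y : Y) :
    busemann (fun t => h (c (t / l))) (h y) = l * busemann c y := by
  refine tendsto_nhds_unique (tendsto_busemann (isometry_similarity hl hd hc) (h y)) ?_
  have h1 := ((tendsto_busemann hc y).comp (tendsto_id.atTop_div_const hl)).const_mul l
  refine h1.congr fun t => ?_
  simp only [Function.comp, id, hd]
  field_simp

end Busemann

/-! ### Inversions, homotheties and asymptotic lines. -/

section Inversive

variable {Y : Type*} [MetricSpace Y]

/-- A metric inversion at `o` of radius `r` that reverses the lines through `o`. The value at `o`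
is irrelevant. -/
structure IsInversion (o : Y) (r : ℝ) (φ : Y → Y) : Prop where
  ne_center : ∀ x, x ≠ o → φ x ≠ o
  involutive : ∀ x, x ≠ o → φ (φ x) = x
  dist_eq : ∀ x y, x ≠ o → y ≠ o → dist (φ x) (φ y) = r ^ 2 * dist x y / (dist x o * dist y o)
  dist_center : ∀ x, x ≠ o → dist (φ x) o = r ^ 2 / dist x o
  line : ∀ c : ℝ → Y, Isometry c → c 0 = o → ∀ t, t ≠ 0 → φ (c t) = c (-(r ^ 2 / t))

/-- A homothety with center `o` and ratio `l` that preserves the lines through `o`. -/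
structure IsHomothety (o : Y) (l : ℝ) (h : Y → Y) : Prop where
  center : h o = o
  dist_eq : ∀ x y, dist (h x) (h y) = l * dist x y
  line : ∀ c : ℝ → Y, Isometry c → c 0 = o → ∀ t, h (c t) = c (l * t)

/-- A Ptolemaic metric space that contains a geodesic line and has inversions at all its points. -/
class InversiveSpace (Y : Type*) [MetricSpace Y] : Prop where
  ptolemy : ∀ x y z w : Y, dist x z * dist y w ≤ dist x y * dist z w + dist x w * dist y z
  exists_line : ∃ c : ℝ → Y, Isometry c
  exists_inversion : ∀ o x : Y, x ≠ o → ∃ φ, IsInversion o (dist x o) φ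

/-- The two reversals of a line through `o` cancel, so `ψ ∘ φ` preserves its direction. The value at
`o` has to be put in by hand. -/
theorem IsInversion.comp {o : Y} {r s : ℝ} {φ ψ : Y → Y} (hφ : IsInversion o r φ)
    (hψ : IsInversion o s ψ) (hr : 0 < r) (hs : 0 < s) :
    ∃ h, IsHomothety o (s ^ 2 / r ^ 2) h := by
  classical
  refine ⟨fun x => if x = o then o else ψ (φ x), by simp, fun x y => ?_, fun c hc h0 t => ?_⟩
  · by_cases hx : x = o <;> by_cases hy : y = o
    · simp [hx, hy]
    · subst hx
      have := dist_pos.2 hy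
      simp only [if_true, if_neg hy]
      rw [dist_comm, hψ.dist_center _ (hφ.ne_center _ hy), hφ.dist_center _ hy, dist_comm x]
      field_simp
    · subst hy
      have := dist_pos.2 hx
      simp only [if_true, if_neg hx]
      rw [hψ.dist_center _ (hφ.ne_center _ hx), hφ.dist_center _ hx]
      field_simp
    · simp only [if_neg hx, if_neg hy]
      have h1 := dist_pos.2 hx
      have h2 := dist_pos.2 hy
      rw [hψ.dist_eq _ _ (hφ.ne_center _ hx) (hφ.ne_center _ hy), hφ.dist_eq _ _ hx hy,
        hφ.dist_center _ hx, hφ.dist_center _ hy]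
      field_simp
  · by_cases ht : t = 0
    · simp [ht, h0]
    · have : c t ≠ o := fun h => ht (hc.injective (h.trans h0.symm))
      simp only [if_neg this]
      rw [hφ.line c hc h0 t ht, hψ.line c hc h0 _ (by simp [ht, hr.ne'])]
      congr 1
      field_simp

variable [InversiveSpace Y] {c c' e : ℝ → Y}

/-- The axiom provides only radii that occur as distances from `o`. Along a line these distances are
continuous and unbounded, so every large radius occurs. -/
theorem exists_inversion_of_large (o : Y) :
    ∃ R : ℝ, 0 < R ∧ ∀ r, R ≤ r → ∃ φ, IsInversion o r φ := by
  obtain ⟨c, hc⟩ := InversiveSpace.exists_line (Y := Y)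
  refine ⟨dist (c 0) o + 1, by positivity, fun r hr => ?_⟩
  have h0 : 0 ≤ dist (c 0) o := dist_nonneg
  have hcont : Continuous fun t => dist (c t) o := hc.continuous.dist continuous_const
  have h1 : r ≤ dist (c (r + dist (c 0) o)) o := by
    have := dist_triangle_right (c (r + dist (c 0) o)) (c 0) o
    rw [hc.dist_eq, Real.dist_eq, abs_of_nonneg (by linarith)] at this
    linarith
  obtain ⟨t, -, ht⟩ := intermediate_value_Icc (by linarith : (0 : ℝ) ≤ r + dist (c 0) o)
    hcont.continuousOn ⟨by linarith, h1⟩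
  rw [← ht]
  exact InversiveSpace.exists_inversion o (c t) (dist_pos.1 (by simp only at ht; linarith))

/-- The composition of inversions needs radii with quotient `√l`. The radii `R * (1 + 1 / √l)` and
`R * (√l + 1)` have it, and both exceed the threshold `R`. -/
theorem exists_homothety (o : Y) {l : ℝ} (hl : 0 < l) : ∃ h, IsHomothety o l h := by
  obtain ⟨R, hR, H⟩ := exists_inversion_of_large o
  have hs := Real.sqrt_pos.2 hl
  obtain ⟨φ, hφ⟩ := H (R * (1 + 1 / √l)) (by
    have : 0 < 1 / √l := by positivity
    nlinarith)
  obtain ⟨ψ, hψ⟩ := H (R * (√l + 1)) (by nlinarith)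
  obtain ⟨h, hh⟩ := hφ.comp hψ (by positivity) (by positivity)
  have : (R * (√l + 1)) ^ 2 / (R * (1 + 1 / √l)) ^ 2 = l := by
    rw [show R * (√l + 1) = √l * (R * (1 + 1 / √l)) by field_simp, mul_pow, Real.sq_sqrt hl.le]
    field_simp
  rw [this] at hh
  exact ⟨h, hh⟩

theorem exists_inversion_line (hc : Isometry c) {r : ℝ} (hr : 0 < r) :
    ∃ φ, IsInversion (c 0) r φ := by
  have h := InversiveSpace.exists_inversion (c 0) (c r) (fun h => hr.ne' (hc.injective h))
  rwa [hc.dist_eq, Real.dist_eq, sub_zero, abs_of_pos hr] at h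

/-- There is an isometric embedding that induces a given translation of a line. -/
theorem exists_shift (hc : Isometry c) (t : ℝ) :
    ∃ g : Y → Y, Isometry g ∧ ∀ s, g (c s) = c (s + t) := by
  -- Doubling at `c 0` and then halving at `c (2 * t)` moves the parameter `s` to `2 * s` and on to
  -- the midpoint `s + t`.
  obtain ⟨h, hh⟩ := exists_homothety (c 0) (l := 2) (by norm_num)
  obtain ⟨k, hk⟩ := exists_homothety (c (2 * t)) (l := 1 / 2) (by norm_num)
  refine ⟨fun x => k (h x), Isometry.of_dist_eq fun x y => ?_, fun s => ?_⟩
  · rw [hk.dist_eq, hh.dist_eq]; ring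
  · have h1 := hk.line (fun u => c (u + 2 * t)) (isometry_comp_add hc _) (by simp) (2 * s - 2 * t)
    simp only at h1 ⊢
    rw [hh.line c hc rfl]
    rw [show 2 * s = 2 * s - 2 * t + 2 * t by ring, h1]
    congr 1; ring

theorem exists_tendsto_hyperfilter {Z : Type*} [MetricSpace Z] [ProperSpace Z] (f : ℕ → Z) (x : Z)
    (R : ℝ) (h : ∀ᶠ n in hyperfilter ℕ, dist (f n) x ≤ R) :
    ∃ y, Tendsto f (hyperfilter ℕ) (𝓝 y) := by
  obtain ⟨y, -, hy⟩ := (isCompact_closedBall x R).ultrafilter_le_nhds ((hyperfilter ℕ).map f)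
    (le_principal_iff.2 h)
  exact ⟨y, hy⟩

theorem eventually_hyperfilter_pos : ∀ᶠ n : ℕ in hyperfilter ℕ, 0 < n :=
  Nat.hyperfilter_le_atTop (eventually_gt_atTop 0)

theorem tendsto_const_div_hyperfilter (a : ℝ) :
    Tendsto (fun n : ℕ => a / n) (hyperfilter ℕ) (𝓝 0) :=
  (tendsto_const_div_atTop_nhds_zero_nat a).mono_left Nat.hyperfilter_le_atTop

/-- Two lines diverge sublinearly (along an ultrafilter). -/
def Asymptotic (c c' : ℝ → Y) : Prop :=
  Tendsto (fun n : ℕ => dist (c n) (c' n) / n) (hyperfilter ℕ) (𝓝 0)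

/-- The line `c` seen from far away: contract it towards `x` by `1 / n` and take the ultralimit. The
contraction carries `c' n` to `c' 1`, so the convergence at parameter `1` is precisely sublinear
divergence. -/
theorem exists_asymptotic [ProperSpace Y] (hc : Isometry c) (x : Y) :
    ∃ c' : ℝ → Y, Isometry c' ∧ c' 0 = x ∧ Asymptotic c c' := by
  have H : ∀ n : ℕ, ∃ h : Y → Y, 0 < n → IsHomothety x (1 / n : ℝ) h := fun n => by
    by_cases hn : 0 < n
    · obtain ⟨h, hh⟩ := exists_homothety x (l := 1 / n) (by positivity)
      exact ⟨h, fun _ => hh⟩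
    · exact ⟨id, fun h => absurd h hn⟩
  choose h hh using H
  have hdx : ∀ n : ℕ, 0 < n → ∀ y, dist (h n y) x = 1 / n * dist y x := fun n hn y => by
    conv_lhs => rw [← (hh n hn).center]
    rw [(hh n hn).dist_eq]
  have key : ∀ t : ℝ, ∃ y, Tendsto (fun n : ℕ => h n (c (n * t))) (hyperfilter ℕ) (𝓝 y) := by
    intro t
    refine exists_tendsto_hyperfilter _ x (dist (c 0) x + |t|) ?_
    filter_upwards [eventually_hyperfilter_pos] with n hn
    rw [hdx n hn]
    have h1 := dist_triangle (c (n * t)) (c 0) x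
    rw [hc.dist_eq, Real.dist_eq, sub_zero, abs_mul, Nat.abs_cast] at h1
    have hn1 : (1 : ℝ) ≤ n := by exact_mod_cast hn
    have h2 : 0 ≤ dist (c 0) x := dist_nonneg
    rw [div_mul_eq_mul_div, one_mul, div_le_iff₀ (by linarith)]
    nlinarith
  choose c' hc' using key
  have iso : Isometry c' := Isometry.of_dist_eq fun s t => by
    refine tendsto_nhds_unique ((hc' s).dist (hc' t)) (tendsto_const_nhds.congr' ?_)
    filter_upwards [eventually_hyperfilter_pos] with n hn
    rw [(hh n hn).dist_eq, hc.dist_eq, Real.dist_eq, Real.dist_eq, ← mul_sub, abs_mul, Nat.abs_cast]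
    have hn1 : (0 : ℝ) < n := by exact_mod_cast hn
    field_simp
  have h0 : c' 0 = x := by
    refine tendsto_nhds_unique (hc' 0) (tendsto_iff_dist_tendsto_zero.2 ?_)
    refine (tendsto_const_div_hyperfilter (dist (c 0) x)).congr' ?_
    filter_upwards [eventually_hyperfilter_pos] with n hn
    rw [hdx n hn, mul_zero]
    ring
  refine ⟨c', iso, h0, ?_⟩
  have h1 := tendsto_iff_dist_tendsto_zero.1 (hc' 1)
  refine h1.congr' ?_
  filter_upwards [eventually_hyperfilter_pos] with n hn
  have hn1 : (0 : ℝ) < n := by exact_mod_cast hn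
  have h2 := (hh n hn).line c' iso h0 n
  rw [one_div, inv_mul_cancel₀ hn1.ne'] at h2
  rw [← h2, (hh n hn).dist_eq, mul_one]
  ring

/-- Busemann functions of asymptotic lines differ by a constant. -/
theorem Asymptotic.busemann_sub (h : Asymptotic c c') (hc : Isometry c) (hc' : Isometry c')
    (x y : Y) : busemann c x - busemann c' x = busemann c y - busemann c' y := by
  have a := tendsto_busemann_nat hc x
  have b := tendsto_busemann_nat hc y
  have a' := tendsto_busemann_nat hc' x
  have b' := tendsto_busemann_nat hc' y
  have hn : Tendsto (fun n : ℕ => (1 : ℝ) / n) (hyperfilter ℕ) (𝓝 0) :=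
    tendsto_const_div_hyperfilter 1
  -- Write each distance as `n` minus its approximant to a Busemann value. In the difference of the
  -- products `dist x (c n) * dist y (c' n)` and `dist x (c' n) * dist y (c n)` the terms `n ^ 2`
  -- cancel, and division by `n` leaves this expression. The Ptolemy inequality bounds it by `dist x
  -- y * dist (c n) (c' n) / n`.
  have l1 := (((a'.add b).sub (a.add b')).add (((a.mul b').sub (a'.mul b)).mul hn)).abs
  have l2 : Tendsto (fun n : ℕ => dist x y * (dist (c n) (c' n) / n)) (hyperfilter ℕ) (𝓝 0) := by
    simpa using h.const_mul (dist x y)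
  have l3 := le_of_tendsto_of_tendsto l1 l2 (by
    filter_upwards [eventually_hyperfilter_pos] with n hn
    have hn1 : (0 : ℝ) < n := by exact_mod_cast hn
    have p1 := InversiveSpace.ptolemy x y (c n) (c' n)
    have p2 := InversiveSpace.ptolemy x y (c' n) (c n)
    rw [dist_comm (c' n) (c n)] at p2
    rw [abs_le]
    constructor
    · rw [← sub_nonneg]
      have : 0 ≤ (dist x y * dist (c n) (c' n) + dist x (c n) * dist y (c' n)
        - dist x (c' n) * dist y (c n)) / n := div_nonneg (by linarith) hn1.le
      refine this.trans_eq ?_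
      field_simp
      ring
    · rw [← sub_nonneg]
      have : 0 ≤ (dist x y * dist (c n) (c' n) + dist x (c' n) * dist y (c n)
        - dist x (c n) * dist y (c' n)) / n := div_nonneg (by linarith) hn1.le
      refine this.trans_eq ?_
      field_simp
      ring)
  rw [mul_zero, add_zero] at l3
  have := abs_eq_zero.1 (le_antisymm l3 (abs_nonneg _))
  linarith

end Inversive

/-! ### Busemann functions are affine along lines. -/

section Flat

variable {Y : Type*} [MetricSpace Y] {c c' e : ℝ → Y}

theorem tendsto_symmetric_difference {f : ℝ → ℝ} (hf : DifferentiableAt ℝ f 0) :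
    Tendsto (fun t : ℝ => t * (f t⁻¹ + f (-t⁻¹) - 2 * f 0)) atTop (𝓝 0) := by
  have h := hasDerivAt_iff_tendsto_slope.1 hf.hasDerivAt
  have i1 : Tendsto (fun t : ℝ => t⁻¹) atTop (𝓝[≠] 0) :=
    tendsto_nhdsWithin_iff.2 ⟨tendsto_inv_atTop_zero, by
      filter_upwards [eventually_gt_atTop 0] with t ht using inv_ne_zero ht.ne'⟩
  have i2 : Tendsto (fun t : ℝ => -t⁻¹) atTop (𝓝[≠] 0) :=
    tendsto_nhdsWithin_iff.2 ⟨by simpa using (tendsto_inv_atTop_zero (𝕜 := ℝ)).neg, by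
      filter_upwards [eventually_gt_atTop 0] with t ht using neg_ne_zero.2 (inv_ne_zero ht.ne')⟩
  have h1 := (h.comp i1).sub (h.comp i2)
  rw [sub_self] at h1
  refine h1.congr' ?_
  filter_upwards [eventually_gt_atTop 0] with t ht
  simp only [Function.comp, slope_def_field]
  field_simp
  ring

/-- The unit inversion exchanges `c t⁻¹` and `c (-t)`, so distances from `z` to points near `c 0`
become distances from `φ z` to points far out in both directions. The left side depends only on the
distances from `z` to the line. -/
theorem IsInversion.tendsto_defect {φ : Y → Y} (hc : Isometry c) (hφ : IsInversion (c 0) 1 φ)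
    {z : Y} (hz : z ≠ c 0) :
    Tendsto (fun t : ℝ => t * (dist z (c t⁻¹) + dist z (c (-t⁻¹)) - 2 * dist z (c 0))) atTop
      (𝓝 (-(busemann c (φ z) + busemann (fun t => c (-t)) (φ z)) * dist z (c 0))) := by
  have h1 := ((tendsto_busemann hc (φ z)).add
    (tendsto_busemann (isometry_comp_neg hc) (φ z))).neg.mul_const (dist z (c 0))
  refine h1.congr' ?_
  filter_upwards [eventually_gt_atTop 0] with t ht
  have hd := dist_pos.2 hz
  have ne : ∀ s : ℝ, s ≠ 0 → c s ≠ c 0 := fun s hs h => hs (hc.injective h)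
  have e1 := hφ.dist_eq z (c (-t⁻¹)) hz (ne _ (by simp [ht.ne']))
  have e2 := hφ.dist_eq z (c t⁻¹) hz (ne _ (by simp [ht.ne']))
  rw [hφ.line c hc rfl _ (by simp [ht.ne']), hc.dist_eq, Real.dist_eq, sub_zero] at e1 e2
  rw [abs_neg, abs_of_pos (by positivity : 0 < t⁻¹)] at e1
  rw [abs_of_pos (by positivity : 0 < t⁻¹)] at e2
  rw [show -((1 : ℝ) ^ 2 / -t⁻¹) = t by field_simp] at e1
  rw [show -((1 : ℝ) ^ 2 / t⁻¹) = -t by field_simp] at e2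
  rw [e1, e2]
  field_simp
  ring

variable [InversiveSpace Y]

/-- The two Busemann functions of a line are opposite. -/
theorem busemann_neg [ProperSpace Y] (hc : Isometry c) (y : Y) :
    busemann (fun t => c (-t)) y = -busemann c y := by
  obtain ⟨φ, hφ⟩ := exists_inversion_line hc one_pos
  suffices H : ∀ z, z ≠ c 0 → busemann c (φ z) + busemann (fun t => c (-t)) (φ z) = 0 by
    by_cases hy : y = c 0
    · have h1 := busemann_line hc 0
      have h2 := busemann_line (isometry_comp_neg hc) 0
      simp only [neg_zero] at h2
      rw [hy, h1, h2, neg_zero]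
    · have := H (φ y) (hφ.ne_center y hy)
      rw [hφ.involutive y hy] at this
      linarith
  intro z hz
  have hd := dist_pos.2 hz
  -- A differentiable distance function has vanishing defect. For general `z` differentiability at
  -- `0` is unknown, but it holds at parameters `u n` tending to `0`, by Rademacher's theorem;
  -- shifting by `-u n` moves them to `0`.
  have zero_of_diff : ∀ x, x ≠ c 0 → DifferentiableAt ℝ (fun s => dist x (c s)) 0 →
      busemann c (φ x) + busemann (fun t => c (-t)) (φ x) = 0 := by
    intro x hx hdiff
    have h := tendsto_nhds_unique (hφ.tendsto_defect hc hx) (tendsto_symmetric_difference hdiff)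
    have := dist_pos.2 hx
    rcases mul_eq_zero.1 h with h | h <;> linarith
  have lip : LipschitzWith 1 fun s => dist z (c s) :=
    LipschitzWith.of_dist_le_mul fun s t => by
      rw [Real.dist_eq, NNReal.coe_one, one_mul, ← hc.dist_eq]
      simpa only [Real.dist_eq, dist_comm z] using abs_dist_sub_le (c s) (c t) z
  have dense : Dense {s : ℝ | DifferentiableAt ℝ (fun s => dist z (c s)) s} :=
    MeasureTheory.Measure.dense_of_ae lip.ae_differentiableAt_real
  have hu : ∀ n : ℕ, ∃ u : ℝ, DifferentiableAt ℝ (fun s => dist z (c s)) u ∧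
      |u| < 1 / ((n : ℝ) + 1) := fun n => by
    obtain ⟨u, hu, hd⟩ := dense.exists_dist_lt 0 (by positivity : (0 : ℝ) < 1 / ((n : ℝ) + 1))
    exact ⟨u, hu, by simpa [Real.dist_eq] using hd⟩
  choose u hu1 hu2 using hu
  have u0 : Tendsto u (hyperfilter ℕ) (𝓝 0) := by
    refine squeeze_zero_norm (fun n => (hu2 n).le) ?_
    exact tendsto_one_div_add_atTop_nhds_zero_nat.mono_left Nat.hyperfilter_le_atTop
  choose g hg1 hg2 using fun n => exists_shift hc (-u n)
  have hgd : ∀ n s, dist (g n z) (c s) = dist z (c (s + u n)) := fun n s => by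
    have := hg2 n (s + u n)
    rw [add_neg_cancel_right] at this
    rw [← this, (hg1 n).dist_eq]
  obtain ⟨w, hw⟩ := exists_tendsto_hyperfilter (fun n => g n z) (c 0) (dist z (c 0) + 1)
    (Eventually.of_forall fun n => by
      rw [hgd]
      have h1 := lip.dist_le_mul (0 + u n) 0
      rw [Real.dist_eq, Real.dist_eq, NNReal.coe_one, one_mul, sub_zero, zero_add] at h1
      have h2 : 1 / ((n : ℝ) + 1) ≤ 1 := by
        rw [div_le_one (by positivity)]; linarith [(n.cast_nonneg : (0 : ℝ) ≤ n)]
      have h3 := le_abs_self (dist z (c (u n)) - dist z (c 0))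
      rw [zero_add]
      linarith [hu2 n])
  -- The limit `w` of the shifted points may differ from `z`, but it has the same distances to the
  -- line and therefore the same defect.
  have hwd : ∀ s, dist w (c s) = dist z (c s) := fun s => by
    refine tendsto_nhds_unique (hw.dist tendsto_const_nhds) ?_
    simp only [hgd]
    have h1 : Tendsto (fun n => s + u n) (hyperfilter ℕ) (𝓝 s) := by simpa using u0.const_add s
    exact (lip.continuous.tendsto s).comp h1
  have hw0 : w ≠ c 0 := dist_pos.1 (by rw [hwd]; exact hd)
  have ev : ∀ᶠ n in hyperfilter ℕ, g n z ≠ c 0 := hw.eventually_ne hw0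
  have hφw : Tendsto (fun n => φ (g n z)) (hyperfilter ℕ) (𝓝 (φ w)) := by
    rw [tendsto_iff_dist_tendsto_zero]
    have h1 : Tendsto (fun n => 1 ^ 2 * dist (g n z) w / (dist (g n z) (c 0) * dist w (c 0)))
        (hyperfilter ℕ) (𝓝 (1 ^ 2 * dist w w / (dist w (c 0) * dist w (c 0)))) :=
      ((hw.dist tendsto_const_nhds).const_mul _).div
        ((hw.dist tendsto_const_nhds).mul_const _)
        (mul_pos (dist_pos.2 hw0) (dist_pos.2 hw0)).ne'
    rw [dist_self, mul_zero, zero_div] at h1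
    refine h1.congr' ?_
    filter_upwards [ev] with n hn
    rw [hφ.dist_eq _ _ hn hw0]
  have hzero : busemann c (φ w) + busemann (fun t => c (-t)) (φ w) = 0 := by
    have h1 := (((continuous_busemann hc).tendsto (φ w)).comp hφw).add
      (((continuous_busemann (isometry_comp_neg hc)).tendsto (φ w)).comp hφw)
    refine tendsto_nhds_unique h1 (tendsto_const_nhds.congr' ?_)
    filter_upwards [ev] with n hn
    refine (zero_of_diff _ hn ?_).symm
    simp only [hgd]
    have h2 := hu1 n
    rw [← zero_add (u n)] at h2
    exact DifferentiableAt.comp (0 : ℝ) (f := fun s => s + u n) h2 (by fun_prop)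
  have l1 := hφ.tendsto_defect hc hz
  have l2 := hφ.tendsto_defect hc hw0
  simp only [hwd, hzero] at l2
  have h := tendsto_nhds_unique l1 l2
  rw [neg_zero, zero_mul] at h
  rcases mul_eq_zero.1 h with h | h <;> linarith

/-- The Ptolemy inequality for three points of `e` and the point `c t` says that the distance to `c
t` is convex along `e`. Let `t` tend to infinity. -/
theorem busemann_concave (hc : Isometry c) (he : Isometry e) {u v w : ℝ} (huv : u < v)
    (hvw : v < w) :
    (v - u) * busemann c (e w) + (w - v) * busemann c (e u) ≤ (w - u) * busemann c (e v) := by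
  have l1 := ((tendsto_busemann hc (e w)).const_mul (v - u)).add
    ((tendsto_busemann hc (e u)).const_mul (w - v))
  refine le_of_tendsto_of_tendsto l1 ((tendsto_busemann hc (e v)).const_mul (w - u))
    (Eventually.of_forall fun t => ?_)
  have h := InversiveSpace.ptolemy (e u) (e v) (e w) (c t)
  simp only [he.dist_eq, Real.dist_eq] at h
  rw [abs_sub_comm u w, abs_sub_comm u v, abs_sub_comm v w, abs_of_pos (by linarith : 0 < w - u),
    abs_of_pos (by linarith : 0 < v - u), abs_of_pos (by linarith : 0 < w - v)] at h
  simp only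
  linarith

theorem busemann_three_points [ProperSpace Y] (hc : Isometry c) (he : Isometry e) {u v w : ℝ}
    (huv : u < v) (hvw : v < w) :
    (v - u) * busemann c (e w) + (w - v) * busemann c (e u) = (w - u) * busemann c (e v) := by
  refine le_antisymm (busemann_concave hc he huv hvw) ?_
  have := busemann_concave (isometry_comp_neg hc) he huv hvw
  simp only [busemann_neg hc] at this
  linarith

/-- Busemann functions are affine along lines. -/
theorem busemann_affine [ProperSpace Y] (hc : Isometry c) (he : Isometry e) (t : ℝ) :
    busemann c (e t) =
      busemann c (e 0) + t * (busemann c (e 1) - busemann c (e 0)) := by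
  rcases lt_trichotomy t 0 with h | h | h
  · have := busemann_three_points hc he h one_pos
    linarith
  · simp [h]
  rcases lt_trichotomy t 1 with h' | h' | h'
  · have := busemann_three_points hc he h h'
    linarith
  · simp [h']
  · have := busemann_three_points hc he one_pos h'
    linarith

/-- Lines with two common points coincide. -/
theorem line_ext (hc : Isometry c) (hc' : Isometry c') (h0 : c 0 = c' 0) {p : ℝ} (hp : p ≠ 0)
    (h : c p = c' p) : c = c' := by
  funext t
  rcases lt_trichotomy (t * p) 0 with ht | ht | ht
  -- The inversion of squared radius `-(t * p)` moves parameter `p` to `t` on both lines at once.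
  -- For parameters of equal sign a homothety of ratio `t / p` does this.
  · obtain ⟨φ, hφ⟩ := exists_inversion_line hc (Real.sqrt_pos.2 (neg_pos.2 ht))
    have h1 := hφ.line c hc rfl p hp
    have h2 := hφ.line c' hc' h0.symm p hp
    rw [Real.sq_sqrt (neg_pos.2 ht).le, show -(-(t * p) / p) = t by field_simp] at h1 h2
    rw [← h1, ← h2, h]
  · rw [(mul_eq_zero.1 ht).resolve_right hp, h0]
  · have hl : 0 < t / p := by
      have := div_pos ht (mul_self_pos.2 hp)
      rwa [mul_div_mul_right _ _ hp] at this
    obtain ⟨g, hg⟩ := exists_homothety (c 0) hl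
    have h1 := hg.line c hc rfl p
    have h2 := hg.line c' hc' h0.symm p
    rw [div_mul_cancel₀ _ hp] at h1 h2
    rw [← h1, ← h2, h]

/-- A line along which the Busemann function of a line with the same origin has slope one
coincides with that line. -/
theorem line_eq_of_busemann [ProperSpace Y] (hc : Isometry c) (hc' : Isometry c')
    (h0 : c 0 = c' 0) {p : ℝ} (hp : 0 < p) (h : busemann c (c' p) = p) : c = c' := by
  have slope : ∀ t, busemann c (c' t) = t := by
    have a0 : busemann c (c' 0) = 0 := by rw [← h0]; exact busemann_line hc 0
    have a1 := busemann_affine hc hc' p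
    rw [h, a0, zero_add, sub_zero] at a1
    intro t
    rw [busemann_affine hc hc' t, a0, zero_add, sub_zero]
    have : busemann c (c' 1) = 1 := by
      have := mul_left_cancel₀ hp.ne' ((mul_one p).trans a1)
      exact this.symm
    rw [this, mul_one]
  -- The slope makes the triangle inequality at the common origin an equality, so the negative half
  -- of `c'` and the positive half of `c` join to a line. It agrees with `c` on a half-line, hence
  -- everywhere, and so `c` and `c'` also share the point at `-1`.
  have far : ∀ s t, 0 < s → t ≤ 0 → dist (c' t) (c s) = s - t := by
    intro s t hs ht
    refine le_antisymm ?_ ?_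
    · have := dist_triangle (c' t) (c' 0) (c s)
      nth_rw 2 [← h0] at this
      rw [hc.dist_eq, hc'.dist_eq, Real.dist_eq, Real.dist_eq, sub_zero, zero_sub, abs_neg,
        abs_of_nonpos ht, abs_of_pos hs] at this
      linarith
    · have := le_busemann hc (c' t) s
      rw [slope] at this
      linarith
  let d : ℝ → Y := fun t => if t ≤ 0 then c' t else c t
  have hd : Isometry d := Isometry.of_dist_eq fun s t => by
    simp only [d]
    split_ifs with hs ht ht
    · exact hc'.dist_eq s t
    · rw [far t s (by linarith) hs, Real.dist_eq, abs_sub_comm, abs_of_pos (by linarith)]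
    · rw [dist_comm, far s t (by linarith) ht, Real.dist_eq, abs_of_pos (by linarith)]
    · exact hc.dist_eq s t
  have e1 : c = d := line_ext hc hd (by simp [d, h0]) one_ne_zero (by simp [d])
  refine line_ext hc hc' h0 (p := -1) (by norm_num) ?_
  rw [e1]
  simp [d]

/-- For two lines with a common origin, the slope of the Busemann function of either along the other
is the same. -/
theorem busemann_slope_comm [ProperSpace Y] (hc : Isometry c) (hc' : Isometry c')
    (h0 : c 0 = c' 0) : busemann c (c' 1) = busemann c' (c 1) := by
  suffices h : busemann c (c' (-1)) = busemann c' (c (-1)) by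
    have h1 := busemann_affine hc hc' (-1)
    have h2 := busemann_affine hc' hc (-1)
    have h3 := busemann_line hc 0
    have h4 := busemann_line hc' 0
    rw [h0] at h3 h2
    rw [← h0] at h4 h1
    rw [← h0] at h3
    rw [h0] at h4
    rw [h3] at h1
    rw [h4] at h2
    linarith
  refine tendsto_nhds_unique (tendsto_busemann hc _)
    ((tendsto_busemann hc' _).congr' ?_)
  filter_upwards [eventually_gt_atTop 0] with s hs
  -- This inversion sends `c s` to `c (-1)` and `c' (-1)` to `c' s`, and the conformal factor is
  -- `1`. So the two approximating functions agree for every `s > 0`.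
  obtain ⟨φ, hφ⟩ := exists_inversion_line hc (Real.sqrt_pos.2 hs)
  have ne : ∀ t : ℝ, t ≠ 0 → c t ≠ c 0 := fun t ht h => ht (hc.injective h)
  have ne' : ∀ t : ℝ, t ≠ 0 → c' t ≠ c 0 := fun t ht h => ht (hc'.injective (h.trans h0))
  have h1 := hφ.line c hc rfl s hs.ne'
  have h2 := hφ.line c' hc' h0.symm (-1) (by norm_num)
  have h3 := hφ.dist_eq (c s) (c' (-1)) (ne s hs.ne') (ne' _ (by norm_num))
  rw [h1, h2, hc.dist_eq, h0, hc'.dist_eq, Real.sq_sqrt hs.le, div_self hs.ne', Real.dist_eq,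
    Real.dist_eq, sub_zero, abs_of_pos hs] at h3
  norm_num at h3
  rw [mul_div_cancel_left₀ _ hs.ne', dist_comm (c s)] at h3
  rw [← h3, div_neg, neg_neg, div_one]

end Flat

/-! ### Fibers of the Busemann values and lines between them. -/

section Base

variable {Y : Type*} [MetricSpace Y] {c c' e : ℝ → Y}

/-- The values of all Busemann functions at a point. -/
noncomputable def busemannMap (y : Y) : {c : ℝ → Y // Isometry c} → ℝ := fun c => busemann c.1 y

variable [InversiveSpace Y] [ProperSpace Y]

theorem busemannMap_affine (hc : Isometry c) (t : ℝ) :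
    busemannMap (c t) = busemannMap (c 0) + t • (busemannMap (c 1) - busemannMap (c 0)) := by
  funext e
  exact busemann_affine e.2 hc t

/-- Each line may be replaced by an asymptotic one through `x`, which changes its Busemann function
by a constant. A line through the center is preserved by `h`, so its Busemann function is multiplied
by `l`. -/
theorem IsHomothety.busemannMap {x : Y} {l : ℝ} {h : Y → Y} (hh : IsHomothety x l h) (hl : 0 < l)
    (y : Y) : busemannMap (h y) =
      busemannMap x + l • (busemannMap y - busemannMap x) := by
  funext ⟨c, hc⟩
  obtain ⟨c', hc', h0, has⟩ := exists_asymptotic hc x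
  have h1 := busemann_similarity hl hh.dist_eq hc' y
  have h2 : (fun t => h (c' (t / l))) = c' := by
    funext t
    rw [hh.line c' hc' h0, mul_div_cancel₀ _ hl.ne']
  rw [h2] at h1
  have h3 := has.busemann_sub hc hc' (h y) x
  have h4 := has.busemann_sub hc hc' y x
  have h5 := busemann_line hc' 0
  rw [h0] at h5
  simp only [MoebiusGeometry.busemannMap, Pi.add_apply, Pi.smul_apply, Pi.sub_apply, smul_eq_mul]
  linear_combination h3 + h1 - l * h4 - (1 - l) * h5

/-- Translations act on the values of the Busemann functions by adding a constant. -/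
theorem exists_translate (x x' z : Y) : ∃ z', dist x' z' = dist x z ∧
    busemannMap z' = busemannMap z + (busemannMap x' - busemannMap x) := by
  -- Expanding by `n` at `x` and contracting by `1 / n` at `x'` is distance-preserving and carries
  -- `x` to within `dist x x' / n` of `x'`. The image of `z` converges along the ultrafilter to the
  -- required point.
  have H : ∀ n : ℕ, ∃ z', 0 < n → |dist x' z' - dist x z| ≤ dist x x' / n ∧
      busemannMap z' = busemannMap z + (busemannMap x' - busemannMap x) +
        (1 / n : ℝ) • (busemannMap x - busemannMap x') := fun n => by
    by_cases hn : 0 < n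
    · have hn1 : (0 : ℝ) < n := by exact_mod_cast hn
      obtain ⟨h, hh⟩ := exists_homothety x hn1
      obtain ⟨k, hk⟩ := exists_homothety x' (l := 1 / n) (by positivity)
      refine ⟨k (h z), fun _ => ⟨?_, ?_⟩⟩
      · have h1 : dist (k (h x)) (k (h z)) = dist x z := by
          rw [hk.dist_eq, hh.dist_eq]; field_simp
        have h2 : dist x' (k (h x)) = dist x x' / n := by
          conv_lhs => rw [← hk.center]
          rw [hk.dist_eq, hh.center, dist_comm]; ring
        rw [← h1, ← h2]
        exact abs_dist_sub_le _ _ _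
      · rw [hk.busemannMap (by positivity), hh.busemannMap hn1]
        funext c
        simp only [Pi.add_apply, Pi.smul_apply, Pi.sub_apply, smul_eq_mul]
        field_simp
        ring
    · exact ⟨z, fun h => absurd h hn⟩
  choose f hf using H
  obtain ⟨z', hz'⟩ := exists_tendsto_hyperfilter f x' (dist x z + dist x x') (by
    filter_upwards [eventually_hyperfilter_pos] with n hn
    have h1 := (abs_le.1 (hf n hn).1).2
    have h2 : dist x x' / n ≤ dist x x' := div_le_self dist_nonneg (by exact_mod_cast hn)
    rw [dist_comm]
    linarith)
  refine ⟨z', ?_, ?_⟩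
  · have h1 := ((tendsto_const_nhds (x := x')).dist hz').sub_const (dist x z) |>.abs
    have h2 := le_of_tendsto_of_tendsto h1 (tendsto_const_div_hyperfilter (dist x x')) (by
      filter_upwards [eventually_hyperfilter_pos] with n hn using (hf n hn).1)
    have := abs_eq_zero.1 (le_antisymm h2 (abs_nonneg _))
    linarith
  · funext c
    have h1 := ((continuous_busemann c.2).tendsto z').comp hz'
    have h2 : Tendsto (fun n : ℕ => busemannMap z c + (busemannMap x' c - busemannMap x c) +
        (busemannMap x c - busemannMap x' c) / n) (hyperfilter ℕ)
        (𝓝 (busemannMap z c + (busemannMap x' c - busemannMap x c) + 0)) :=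
      (tendsto_const_div_hyperfilter _).const_add _
    rw [add_zero] at h2
    refine tendsto_nhds_unique h1 (h2.congr' ?_)
    filter_upwards [eventually_hyperfilter_pos] with n hn
    have := congrFun (hf n hn).2 c
    simp only [Pi.add_apply, Pi.smul_apply, Pi.sub_apply, smul_eq_mul] at this
    change _ = busemannMap (f n) c
    rw [this]
    ring

theorem tendsto_floor_mul_div (a : ℝ) :
    Tendsto (fun n : ℕ => (⌊a * n⌋ : ℝ) / n) (hyperfilter ℕ) (𝓝 a) := by
  rw [tendsto_iff_dist_tendsto_zero]
  refine squeeze_zero' (Eventually.of_forall fun _ => dist_nonneg) ?_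
    (tendsto_const_div_hyperfilter 1)
  filter_upwards [eventually_hyperfilter_pos] with n hn
  have hn1 : (0 : ℝ) < n := by exact_mod_cast hn
  have h1 := Int.floor_le (a * n)
  have h2 := Int.lt_floor_add_one (a * n)
  rw [Real.dist_eq, show (⌊a * n⌋ : ℝ) / n - a = (⌊a * n⌋ - a * n) / n by field_simp, abs_div,
    abs_of_pos hn1]
  gcongr
  rw [abs_le]
  constructor <;> linarith

/-- A point whose distance `δ` from `x` is minimal in its fiber is a lower bound for all distances
over proportional displacements. -/
theorem le_dist_of_minimal {x y : Y}
    (hmin : ∀ y', busemannMap y' = busemannMap y → dist x y ≤ dist x y') {a b : Y} {ρ : ℝ}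
    (hρ : 0 < ρ) (h : busemannMap b = busemannMap a + ρ • (busemannMap y - busemannMap x)) :
    ρ * dist x y ≤ dist a b := by
  obtain ⟨k, hk⟩ := exists_homothety a (inv_pos.2 hρ)
  obtain ⟨z, hz1, hz2⟩ := exists_translate a x (k b)
  -- Contracting `b` towards `a` by `ρ⁻¹` and translating `a` to `x` lands in the fiber of `y`.
  have h1 := hmin z (by
    rw [hz2, hk.busemannMap (inv_pos.2 hρ), h, add_sub_cancel_left, smul_smul,
      inv_mul_cancel₀ hρ.ne', one_smul]
    abel)
  have h2 : dist a (k b) = ρ⁻¹ * dist a b := by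
    conv_lhs => rw [← hk.center]
    rw [hk.dist_eq]
  rw [hz1, h2] at h1
  calc ρ * dist x y ≤ ρ * (ρ⁻¹ * dist a b) := by gcongr
    _ = dist a b := by field_simp

/-- One step from `z` translates the pair `(x, y)` to start at `z` and contracts the displacement by
`ε`; the pair `(y, x)` gives the backward steps. -/
theorem exists_chain (x y : Y) {ε : ℝ} (hε : 0 < ε) :
    ∃ q : ℤ → Y, q 0 = x ∧ (∀ i, dist (q i) (q (i + 1)) ≤ ε * dist x y) ∧
      ∀ i : ℤ, busemannMap (q i) =
        busemannMap x + (i * ε : ℝ) • (busemannMap y - busemannMap x) := by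
  have fwd : ∀ z : Y, ∃ z', dist z z' = ε * dist x y ∧
      busemannMap z' = busemannMap z + ε • (busemannMap y - busemannMap x) := fun z => by
    obtain ⟨k, hk⟩ := exists_homothety z hε
    obtain ⟨w, hw1, hw2⟩ := exists_translate x z y
    refine ⟨k w, ?_, ?_⟩
    · conv_lhs => rw [← hk.center]
      rw [hk.dist_eq, hw1]
    · rw [hk.busemannMap hε, hw2]
      congr 2
      abel
  have bwd : ∀ z : Y, ∃ z', dist z z' = ε * dist x y ∧
      busemannMap z' = busemannMap z - ε • (busemannMap y - busemannMap x) := fun z => by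
    obtain ⟨k, hk⟩ := exists_homothety z hε
    obtain ⟨w, hw1, hw2⟩ := exists_translate y z x
    refine ⟨k w, ?_, ?_⟩
    · conv_lhs => rw [← hk.center]
      rw [hk.dist_eq, hw1, dist_comm y]
    · rw [hk.busemannMap hε, hw2, sub_eq_add_neg (busemannMap z) (ε • _), ← smul_neg]
      congr 2
      abel
  choose f hf1 hf2 using fwd
  choose g hg1 hg2 using bwd
  let q : ℤ → Y := fun i => Int.rec (fun n => f^[n] x) (fun n => g^[n + 1] x) i
  have qf : ∀ n : ℕ, q (n : ℤ) = f^[n] x := fun n => rfl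
  have qg : ∀ n : ℕ, q (-(n : ℤ)) = g^[n] x := fun n => by
    cases n with
    | zero => rfl
    | succ n => rfl
  refine ⟨q, rfl, fun i => ?_, fun i => ?_⟩
  · rcases Int.le_total 0 i with hi | hi
    · obtain ⟨n, rfl⟩ := Int.eq_ofNat_of_zero_le hi
      have := qf (n + 1)
      push_cast at this
      rw [this, qf, Function.iterate_succ_apply']
      exact (hf1 _).le
    · obtain ⟨n, hn⟩ := Int.eq_ofNat_of_zero_le (neg_nonneg.2 hi)
      obtain rfl : i = -(n : ℤ) := by omega
      cases n with
      | zero =>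
        have := qf 1
        simp only [Nat.cast_one] at this
        simp only [Nat.cast_zero, neg_zero, zero_add, this, Function.iterate_one]
        exact (hf1 _).le
      | succ n =>
        have h1 : -((n + 1 : ℕ) : ℤ) + 1 = -(n : ℤ) := by push_cast; ring
        rw [h1, qg, qg, Function.iterate_succ_apply', dist_comm]
        exact (hg1 _).le
  · rcases Int.le_total 0 i with hi | hi
    · obtain ⟨n, rfl⟩ := Int.eq_ofNat_of_zero_le hi
      rw [qf]
      induction n with
      | zero => simp
      | succ n ih =>
        rw [Function.iterate_succ_apply', hf2, ih (by omega)]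
        push_cast
        rw [add_assoc, ← add_smul]
        congr 2
        ring
    · obtain ⟨n, hn⟩ := Int.eq_ofNat_of_zero_le (neg_nonneg.2 hi)
      obtain rfl : i = -(n : ℤ) := by omega
      clear hn hi
      rw [qg]
      induction n with
      | zero => simp
      | succ n ih =>
        rw [Function.iterate_succ_apply', hg2, ih]
        push_cast
        rw [add_sub_assoc, ← sub_smul]
        congr 2
        ring

/-- A point and a fiber that does not contain it are joined by a line. -/
theorem exists_line_of_busemannMap_ne {x y : Y} (hne : busemannMap x ≠ busemannMap y) :
    ∃ (c : ℝ → Y) (δ : ℝ), Isometry c ∧ 0 < δ ∧ c 0 = x ∧ busemannMap (c δ) = busemannMap y := by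
  let S : Set Y := {y' | busemannMap y' = busemannMap y}
  have hS : IsClosed S := by
    have : S = ⋂ c : {c : ℝ → Y // Isometry c}, {y' | busemann c.1 y' = busemann c.1 y} := by
      ext y'
      simp only [S, Set.mem_ofPred_eq, Set.mem_iInter]
      exact funext_iff
    rw [this]
    exact isClosed_iInter fun c => isClosed_eq (continuous_busemann c.2) continuous_const
  obtain ⟨y₀, hy₀, hy₀'⟩ := hS.exists_infDist_eq_dist ⟨y, rfl⟩ x
  have hy₁ : busemannMap y₀ = busemannMap y := hy₀
  have hmin : ∀ y', busemannMap y' = busemannMap y₀ → dist x y₀ ≤ dist x y' := fun y' hy' => by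
    rw [← hy₀']
    exact Metric.infDist_le_dist_of_mem (hy'.trans hy₀)
  set δ := dist x y₀ with hδ
  have hδ0 : 0 < δ := dist_pos.2 fun h => hne (by rw [h, hy₁])
  -- The steps of the chain have length at most `δ / n`. Since `y₀` is nearest to `x` in its fiber,
  -- `k` steps cover at least `k * (δ / n)`, so the chain is a discrete geodesic.
  have H : ∀ n : ℕ, ∃ q : ℤ → Y, 0 < n → q 0 = x ∧
      (∀ i j : ℤ, dist (q i) (q j) = |(i - j : ℝ)| * (δ / n)) ∧
      ∀ i : ℤ, busemannMap (q i) =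
        busemannMap x + (i / n : ℝ) • (busemannMap y₀ - busemannMap x) := fun n => by
    by_cases hn : 0 < n
    · have hn1 : (0 : ℝ) < n := by exact_mod_cast hn
      obtain ⟨q, h0, h1, h2⟩ := exists_chain x y₀ (inv_pos.2 hn1)
      refine ⟨q, fun _ => ⟨h0, ?_, fun i => by rw [h2, div_eq_mul_inv]⟩⟩
      have up : ∀ (i : ℤ) (k : ℕ), dist (q i) (q (i + k)) ≤ k * (δ / n) := fun i k => by
        induction k with
        | zero => simp
        | succ k ih =>
          have h3 := dist_triangle (q i) (q (i + k)) (q (i + k + 1))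
          have h4 := h1 (i + k)
          push_cast
          rw [← add_assoc]
          rw [inv_mul_eq_div] at h4
          linarith
      have eq : ∀ (i : ℤ) (k : ℕ), dist (q i) (q (i + k)) = k * (δ / n) := fun i k => by
        refine le_antisymm (up i k) ?_
        rcases Nat.eq_zero_or_pos k with rfl | hk
        · simp
        have hk1 : (0 : ℝ) < k := by exact_mod_cast hk
        have := le_dist_of_minimal hmin (a := q i) (b := q (i + k)) (ρ := k / n) (by positivity) (by
          rw [h2, h2, add_assoc, ← add_smul]
          congr 2
          push_cast
          field_simp)
        refine le_trans (le_of_eq ?_) this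
        ring
      intro i j
      rcases le_total i j with hij | hij
      · obtain ⟨k, rfl⟩ := Int.le.dest hij
        rw [eq]
        simp
      · obtain ⟨k, rfl⟩ := Int.le.dest hij
        rw [dist_comm, eq]
        simp
    · exact ⟨fun _ => x, fun h => absurd h hn⟩
  choose q hq using H
  -- Arc length `t` corresponds to the index `t / δ * n`. At `t = δ` this is exactly `n`, where the
  -- chain has the Busemann values of `y₀`.
  have hl : ∀ s t : ℝ, Tendsto (fun n : ℕ =>
      dist (q n ⌊s / δ * n⌋) (q n ⌊t / δ * n⌋)) (hyperfilter ℕ) (𝓝 |s - t|) := fun s t => by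
    have h1 := (((tendsto_floor_mul_div (s / δ)).sub
      (tendsto_floor_mul_div (t / δ))).abs).mul_const δ
    rw [← sub_div, abs_div, abs_of_pos hδ0, div_mul_cancel₀ _ hδ0.ne'] at h1
    refine h1.congr' ?_
    filter_upwards [eventually_hyperfilter_pos] with n hn
    have hn1 : (0 : ℝ) < n := by exact_mod_cast hn
    rw [(hq n hn).2.1, ← sub_div, abs_div, abs_of_pos hn1]
    ring
  have hex : ∀ t : ℝ, ∃ z, Tendsto (fun n : ℕ => q n ⌊t / δ * n⌋) (hyperfilter ℕ) (𝓝 z) := by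
    intro t
    refine exists_tendsto_hyperfilter _ x (|t - 0| + 1) ?_
    filter_upwards [(hl t 0).eventually_le_const (lt_add_one _), eventually_hyperfilter_pos]
      with n hn hn'
    simpa [(hq n hn').1] using hn
  choose c hc using hex
  have hiso : Isometry c := Isometry.of_dist_eq fun s t => by
    rw [Real.dist_eq]
    exact tendsto_nhds_unique ((hc s).dist (hc t)) (hl s t)
  refine ⟨c, δ, hiso, hδ0, ?_, ?_⟩
  · refine tendsto_nhds_unique (hc 0) (tendsto_const_nhds.congr' ?_)
    filter_upwards [eventually_hyperfilter_pos] with n hn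
    simp [(hq n hn).1]
  · rw [← hy₁]
    funext e
    have h1 := ((continuous_busemann e.2).tendsto _).comp (hc δ)
    refine tendsto_nhds_unique h1 (tendsto_const_nhds.congr' ?_)
    filter_upwards [eventually_hyperfilter_pos] with n hn
    have hn1 : (0 : ℝ) < n := by exact_mod_cast hn
    have h2 := congrFun ((hq n hn).2.2 n) e
    simp only [Function.comp, div_self hδ0.ne', one_mul, Int.floor_natCast]
    change _ = busemannMap _ e
    simp only [Int.cast_natCast, div_self hn1.ne', one_smul] at h2
    rw [h2]
    simp

end Base

/-- A space with a positive definite inner product is Euclidean if its unit ball is the image of a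
ball of a proper space under a 1-Lipschitz map. -/
theorem exists_euclidean_coordinates {V Z : Type*} [AddCommGroup V] [Module ℝ V]
    (core : InnerProductSpace.Core ℝ V) [MetricSpace Z] [ProperSpace Z] (o : Z) (p : Z → V)
    (hp : ∀ x y, core.inner (p x - p y) (p x - p y) ≤ dist x y ^ 2)
    (hs : ∀ v, ∃ y, p y = v ∧ dist y o ^ 2 = core.inner v v) :
    ∃ (k : ℕ) (L : V ≃ₗ[ℝ] EuclideanSpace ℝ (Fin k)), ∀ v, ‖L v‖ ^ 2 = core.inner v v := by
  let : NormedAddCommGroup V := core.toNormedAddCommGroup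
  let : InnerProductSpace ℝ V := InnerProductSpace.ofCore core.toCore
  have hn : ∀ v : V, ‖v‖ ^ 2 = core.inner v v := fun v => (real_inner_self_eq_norm_sq v).symm
  have hlip : LipschitzWith 1 p := LipschitzWith.of_dist_le_mul fun x y => by
    rw [NNReal.coe_one, one_mul, dist_eq_norm]
    exact abs_le_of_sq_le_sq' (by rw [hn]; exact hp x y) dist_nonneg |>.2
  have himg : Metric.closedBall (0 : V) 1 ⊆ p '' Metric.closedBall o 1 := fun v hv => by
    obtain ⟨y, rfl, hy⟩ := hs v
    refine ⟨y, ?_, rfl⟩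
    rw [mem_closedBall_zero_iff] at hv
    rw [Metric.mem_closedBall, ← abs_of_nonneg (dist_nonneg (x := y) (y := o)),
      ← sq_le_one_iff_abs_le_one,
      hy, ← hn, sq_le_one_iff_abs_le_one, abs_of_nonneg (norm_nonneg _)]
    exact hv
  have hcomp : IsCompact (Metric.closedBall (0 : V) 1) :=
    ((isCompact_closedBall o 1).image hlip.continuous).of_isClosed_subset
      Metric.isClosed_closedBall himg
  have : FiniteDimensional ℝ V := FiniteDimensional.of_isCompact_closedBall ℝ one_pos hcomp
  let b := stdOrthonormalBasis ℝ V
  exact ⟨_, b.repr.toLinearEquiv, fun v => by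
    rw [← hn]
    exact congrArg (· ^ 2) (b.repr.norm_map v)⟩

/-! ### The Euclidean base. -/

section Base

variable {Y : Type*} [MetricSpace Y] [InversiveSpace Y] [ProperSpace Y] {c c' e : ℝ → Y}

/-- The differences of the values of the Busemann functions, at all points and at a base point. -/
def displacements (o : Y) : Submodule ℝ ({c : ℝ → Y // Isometry c} → ℝ) where
  carrier := {v | ∃ y, v = busemannMap y - busemannMap o}
  zero_mem' := ⟨o, (sub_self _).symm⟩
  add_mem' := by
    rintro _ _ ⟨x, rfl⟩ ⟨y, rfl⟩
    obtain ⟨z, -, hz⟩ := exists_translate o y x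
    exact ⟨z, by rw [hz]; abel⟩
  smul_mem' := by
    have pos : ∀ (r : ℝ) (x : Y), 0 < r →
        ∃ z, r • (busemannMap x - busemannMap o) = busemannMap z - busemannMap o := fun r x hr => by
      obtain ⟨h, hh⟩ := exists_homothety o hr
      exact ⟨h x, by rw [hh.busemannMap hr]; abel⟩
    rintro r _ ⟨x, rfl⟩
    rcases lt_trichotomy r 0 with hr | rfl | hr
    -- Translating `x` to `o` takes `o` to a point with the opposite displacement, which reduces
    -- negative scalars to positive ones.
    · obtain ⟨y, -, hy⟩ := exists_translate x o o
      obtain ⟨z, hz⟩ := pos (-r) y (neg_pos.2 hr)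
      refine ⟨z, ?_⟩
      rw [← hz, hy, neg_smul, ← smul_neg]
      congr 1
      abel
    · exact ⟨o, by rw [zero_smul, sub_self]⟩
    · exact pos r x hr

/-- The segment from `o` realizing `v` has length `δ`. Its own Busemann function grows by `δ`, and
no other can grow by more, being 1-Lipschitz. So `δ` is the supremum of the entries of `v`. -/
theorem exists_direction {o : Y} (v : displacements o) :
    ∃ (δ : ℝ) (c : ℝ → Y) (hc : Isometry c), 0 ≤ δ ∧ c 0 = o ∧
      busemannMap (c δ) = busemannMap o + v.1 ∧
      v.1 = δ • (busemannMap (c 1) - busemannMap (c 0)) ∧ v.1 ⟨c, hc⟩ = δ ∧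
      ∀ c', v.1 c' ≤ δ := by
  suffices H : ∃ (δ : ℝ) (c : ℝ → Y), Isometry c ∧ 0 ≤ δ ∧ c 0 = o ∧
      busemannMap (c δ) = busemannMap o + v.1 by
    obtain ⟨δ, c, hc, hδ, h0, h1⟩ := H
    have h2 : v.1 = δ • (busemannMap (c 1) - busemannMap (c 0)) := by
      rw [busemannMap_affine hc δ, h0] at h1
      rw [h0]
      exact (add_left_cancel h1).symm
    refine ⟨δ, c, hc, hδ, h0, h1, h2, ?_, fun c' => ?_⟩
    · rw [h2]
      have e1 : busemannMap (c 1) ⟨c, hc⟩ = 1 := busemann_line hc 1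
      have e0 : busemannMap (c 0) ⟨c, hc⟩ = 0 := busemann_line hc 0
      simp [e1, e0]
    · have h3 := congrFun h1 c'
      have h4 := busemann_sub_le c'.2 (c δ) (c 0)
      rw [hc.dist_eq, Real.dist_eq, sub_zero, abs_of_nonneg hδ, h0] at h4
      simp only [busemannMap, Pi.add_apply] at h3
      linarith
  obtain ⟨v, y, rfl⟩ := v
  by_cases h : busemannMap o = busemannMap y
  -- The zero displacement needs some line through `o`; an asymptotic line supplies one.
  · obtain ⟨c₀, hc₀⟩ := InversiveSpace.exists_line (Y := Y)
    obtain ⟨c, hc, h0, -⟩ := exists_asymptotic hc₀ o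
    exact ⟨0, c, hc, le_rfl, h0, by simp [h0, h]⟩
  · obtain ⟨c, δ, hc, hδ, h0, h1⟩ := exists_line_of_busemannMap_ne h
    exact ⟨δ, c, hc, hδ.le, h0, by rw [h1]; simp⟩

/-- The product of `v` and `w` is `δ v` times the entry of `w` at the line of `v`. It is visibly
linear in `w`, and symmetry of slopes transfers linearity to `v`, even though the line of `v` is
merely chosen. -/
theorem exists_core (o : Y) : ∃ core : InnerProductSpace.Core ℝ (displacements o),
    ∀ v : displacements o, ∃ (δ : ℝ) (c : ℝ → Y) (hc : Isometry c), 0 ≤ δ ∧ c 0 = o ∧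
      busemannMap (c δ) = busemannMap o + v.1 ∧ v.1 ⟨c, hc⟩ = δ ∧ (∀ c', v.1 c' ≤ δ) ∧
      core.inner v v = δ ^ 2 := by
  choose δ c hc hδ h0 h1 h2 h3 h4 using fun v : displacements o => exists_direction v
  have symm : ∀ v w : displacements o, δ v * w.1 ⟨c v, hc v⟩ = δ w * v.1 ⟨c w, hc w⟩ := by
    intro v w
    have e := busemann_slope_comm (hc v) (hc w) ((h0 v).trans (h0 w).symm)
    have e1 := busemann_line (hc v) 0
    have e2 := busemann_line (hc w) 0
    rw [h0] at e1 e2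
    rw [h2 v, h2 w, h0 v, h0 w]
    simp only [busemannMap, Pi.smul_apply, Pi.sub_apply, smul_eq_mul, e, e1, e2]
    ring
  have self : ∀ v : displacements o, δ v * v.1 ⟨c v, hc v⟩ = δ v ^ 2 := fun v => by
    rw [h3, sq]
  refine ⟨{ inner := fun v w => δ v * w.1 ⟨c v, hc v⟩
            conj_inner_symm := fun v w => ?_
            re_inner_nonneg := fun v => ?_
            add_left := fun u v w => ?_
            smul_left := fun v w r => ?_
            definite := fun v hv => ?_ }, fun v =>
              ⟨δ v, c v, hc v, hδ v, h0 v, h1 v, h3 v, h4 v, self v⟩⟩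
  · simp only [conj_trivial]
    exact symm w v
  · simp only [self]
    exact sq_nonneg _
  · simp only [symm _ w]
    simp only [Submodule.coe_add, Pi.add_apply]
    ring
  · simp only [symm _ w, conj_trivial]
    simp only [Submodule.coe_smul, Pi.smul_apply, smul_eq_mul]
    ring
  · simp only [self] at hv
    have : δ v = 0 := by simpa using hv
    exact Subtype.ext (by rw [h2 v, this, zero_smul]; rfl)

/-- The base of the space: a Euclidean space whose distance is the maximal difference of the values
of a Busemann function. -/
theorem exists_base [Nonempty Y] :
    ∃ (k : ℕ) (π : Y → EuclideanSpace ℝ (Fin k)), 1 ≤ k ∧ Function.Surjective π ∧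
      (∀ x y, IsGreatest {r | ∃ c, Isometry c ∧ r = busemann c x - busemann c y}
        (dist (π x) (π y))) ∧
      ∀ x y, π x ≠ π y → ∃ c, Isometry c ∧ c 0 = x ∧ π (c (dist (π x) (π y))) = π y := by
  obtain ⟨o⟩ := ‹Nonempty Y›
  obtain ⟨core, hcore⟩ := exists_core o
  let p : Y → displacements o := fun y => ⟨busemannMap y - busemannMap o, y, rfl⟩
  have hp : ∀ x y, (p x - p y).1 = busemannMap x - busemannMap y := fun x y =>
    sub_sub_sub_cancel_right _ _ _
  obtain ⟨k, L, hL⟩ := exists_euclidean_coordinates core o p (fun x y => by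
    obtain ⟨δ, c, hc, hδ, -, -, h1, -, h2⟩ := hcore (p x - p y)
    rw [h2]
    refine pow_le_pow_left₀ hδ ?_ 2
    rw [← h1, hp]
    exact busemann_sub_le hc x y) (fun v => by
    obtain ⟨δ, c, hc, hδ, h0, h1, -, -, h2⟩ := hcore v
    refine ⟨c δ, Subtype.ext ?_, ?_⟩
    · change busemannMap (c δ) - busemannMap o = v.1
      rw [h1, add_sub_cancel_left]
    · rw [h2]
      nth_rw 1 [← h0]
      rw [hc.dist_eq, Real.dist_eq, sub_zero, sq_abs])
  let π : Y → EuclideanSpace ℝ (Fin k) := fun y => L (p y)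
  have hgreatest : ∀ x y, IsGreatest {r | ∃ c, Isometry c ∧ r = busemann c x - busemann c y}
      (dist (π x) (π y)) := fun x y => by
    obtain ⟨δ, c, hc, hδ, -, -, h1, h2, h3⟩ := hcore (p x - p y)
    have : dist (π x) (π y) = δ := by
      rw [dist_eq_norm, ← map_sub, ← abs_of_nonneg (norm_nonneg _), ← abs_of_nonneg hδ,
        ← sq_eq_sq_iff_abs_eq_abs,
        hL, h3]
    rw [this]
    rw [hp] at h1 h2
    refine ⟨⟨c, hc, h1.symm⟩, ?_⟩
    rintro _ ⟨c', hc', rfl⟩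
    exact h2 ⟨c', hc'⟩
  have hπ : ∀ x y, busemannMap x = busemannMap y → π x = π y := fun x y h => by
    simp only [π, p, h]
  have hline : ∀ c : ℝ → Y, Isometry c → ∀ δ, 0 ≤ δ → dist (π (c 0)) (π (c δ)) = δ := by
    intro c hc δ hδ
    rw [dist_comm]
    refine le_antisymm ?_ ((hgreatest _ _).2 ⟨c, hc, ?_⟩)
    · obtain ⟨e, he, h⟩ := (hgreatest (c δ) (c 0)).1
      rw [h]
      refine (busemann_sub_le he _ _).trans ?_
      rw [hc.dist_eq, Real.dist_eq, sub_zero, abs_of_nonneg hδ]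
    · rw [busemann_line hc, busemann_line hc, sub_zero]
  refine ⟨k, π, ?_, ?_, hgreatest, ?_⟩
  · obtain ⟨c, hc⟩ := InversiveSpace.exists_line (Y := Y)
    by_contra hk
    obtain rfl : k = 0 := by omega
    have := hline c hc 1 zero_le_one
    rw [Subsingleton.elim (π (c 0)) (π (c 1)), dist_self] at this
    exact zero_ne_one this
  · intro b
    obtain ⟨⟨_, y, rfl⟩, hv⟩ := L.surjective b
    exact ⟨y, hv⟩
  · intro x y hxy
    obtain ⟨c, δ, hc, hδ, h0, h1⟩ := exists_line_of_busemannMap_ne fun h => hxy (hπ x y h)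
    refine ⟨c, hc, h0, ?_⟩
    have h2 := hline c hc δ hδ.le
    rw [h0, hπ _ _ h1] at h2
    rw [h2, hπ _ _ h1]

end Base

/-! ### Extended metrics: rescaling, pullback and inversion. -/

theorem SameRatio.symm {a b : Fin 3 → ℝ} (h : SameRatio a b) : SameRatio b a := by
  obtain ⟨c, hc, rfl⟩ := h
  exact ⟨c⁻¹, inv_ne_zero hc, by rw [smul_smul, inv_mul_cancel₀ hc, one_smul]⟩

namespace ExtMetric

variable {X : Type u} {d e : ExtMetric X} {ω x y z w a b : X}

theorem factor_comm (x y : X) : d.factor x y = d.factor y x := by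
  unfold factor
  rw [d.dist_comm]

theorem factor_self (x : X) : d.factor x x = 0 := (d.factor_eq_zero_iff x x).2 rfl

theorem factor_nonneg (x y : X) : 0 ≤ d.factor x y := by
  unfold factor
  split_ifs
  · exact zero_le_one
  · exact ENNReal.toReal_nonneg

theorem factor_pos (h : x ≠ y) : 0 < d.factor x y :=
  (d.factor_nonneg x y).lt_of_ne fun h' => h ((d.factor_eq_zero_iff x y).1 h'.symm)

theorem dist_ne_top (hx : d.remote ≠ some x) (hy : d.remote ≠ some y) : d.dist x y ≠ ∞ := by
  rw [Ne, d.dist_eq_top_iff]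
  tauto

theorem dist_remote (h : d.remote = some ω) (hx : x ≠ ω) : d.dist x ω = ∞ :=
  (d.dist_eq_top_iff x ω).2 ⟨hx, Or.inr h⟩

theorem factor_remote (h : d.remote = some ω) (hx : x ≠ ω) : d.factor x ω = 1 := by
  rw [factor, if_pos (dist_remote h hx)]

theorem factor_remote' (h : d.remote = some ω) (hx : x ≠ ω) : d.factor ω x = 1 := by
  rw [factor_comm, factor_remote h hx]

theorem ofReal_factor (h : d.dist x y ≠ ∞) : ENNReal.ofReal (d.factor x y) = d.dist x y := by
  rw [factor, if_neg h, ENNReal.ofReal_toReal h]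

theorem remote_ne_of_ne (h : d.remote = some ω) (hx : x ≠ ω) : d.remote ≠ some x := by
  rw [h]
  exact fun h' => hx (Option.some.inj h').symm

/-- Replacing `∞` by `1` is harmless unless the middle point is remote: for a remote end point both
long distances become `1`. -/
theorem factor_triangle (hx : d.remote ≠ some x) (y a : X) :
    d.factor y a ≤ d.factor y x + d.factor x a := by
  have htri := d.dist_triangle y x a
  have n1 := d.factor_nonneg y x
  have n2 := d.factor_nonneg x a
  by_cases h1 : d.dist y x = ∞
  · have f1 : d.factor y x = 1 := by rw [factor, if_pos h1]
    have hy := ((d.dist_eq_top_iff y x).1 h1).2.resolve_right hx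
    by_cases h : y = a
    · rw [h, factor_self]
      rw [h] at n1
      linarith
    · rw [factor_remote' hy (Ne.symm h)]
      linarith
  by_cases h2 : d.dist x a = ∞
  · have f1 : d.factor x a = 1 := by rw [factor, if_pos h2]
    have ha := ((d.dist_eq_top_iff x a).1 h2).2.resolve_left hx
    by_cases h : y = a
    · rw [h, factor_self]
      rw [h] at n1
      linarith
    · rw [factor_remote ha h]
      linarith
  have h3 : d.dist y a ≠ ∞ := (htri.trans_lt (ENNReal.add_lt_top.2
    ⟨Ne.lt_top h1, Ne.lt_top h2⟩)).ne
  rw [factor, factor, factor, if_neg h1, if_neg h2, if_neg h3, ← ENNReal.toReal_add h1 h2]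
  exact ENNReal.toReal_mono (ENNReal.add_ne_top.2 ⟨h1, h2⟩) htri

theorem MoebiusEquiv.symm (h : d.MoebiusEquiv e) : e.MoebiusEquiv d :=
  fun x y z w hxy => (h x y z w hxy).symm

/-- Moebius equivalence in terms of the ratio of the factors. -/
theorem MoebiusEquiv.exists_pos (h : d.MoebiusEquiv e) (hadm : Admissible x y z w) :
    ∃ c : ℝ, 0 < c ∧ e.factor x y * e.factor z w = c * (d.factor x y * d.factor z w) ∧
      e.factor x z * e.factor y w = c * (d.factor x z * d.factor y w) ∧
      e.factor x w * e.factor y z = c * (d.factor x w * d.factor y z) := by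
  obtain ⟨c, hc, hcrt⟩ := h.symm x y z w hadm
  have h0 := congrFun hcrt 0
  have h1 := congrFun hcrt 1
  have h2 := congrFun hcrt 2
  simp only [crt, Matrix.cons_val, Pi.smul_apply, smul_eq_mul] at h0 h1 h2
  refine ⟨c, lt_of_le_of_ne (not_lt.1 fun hneg => ?_) hc.symm, h0, h1, h2⟩
  have key : ∀ p q r s : X, e.factor p q * e.factor r s = c * (d.factor p q * d.factor r s) →
      e.factor p q * e.factor r s = 0 := fun p q r s h => by
    have h1 : 0 ≤ e.factor p q * e.factor r s := mul_nonneg (factor_nonneg _ _) (factor_nonneg _ _)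
    have h2 : 0 ≤ d.factor p q * d.factor r s := mul_nonneg (factor_nonneg _ _) (factor_nonneg _ _)
    nlinarith
  refine e.crt_ne_zero hadm ?_
  funext i
  fin_cases i
  · simpa [crt] using key _ _ _ _ h0
  · simpa [crt] using key _ _ _ _ h1
  · simpa [crt] using key _ _ _ _ h2

theorem admissible_of_ne (h1 : x ≠ y) (h2 : x ≠ z) (h3 : y ≠ z) : Admissible x y z w :=
  ⟨fun h => h1 h.1, fun h => h1 h.1, fun h => h2 h.1, fun h => h3 h.1⟩

/-- Moebius equivalent metrics with the same infinitely remote point are proportional. -/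
theorem MoebiusEquiv.exists_scale (h : d.MoebiusEquiv e) (hd : d.remote = some ω)
    (he : e.remote = some ω) :
    ∃ l : ℝ, 0 < l ∧ ∀ x y, x ≠ ω → y ≠ ω → e.factor x y = l * d.factor x y := by
  by_cases hX : ∃ p q : X, p ≠ ω ∧ q ≠ ω ∧ p ≠ q
  · obtain ⟨p, q, hp, hq, hpq⟩ := hX
    have key : ∀ x y z, x ≠ ω → y ≠ ω → z ≠ ω → x ≠ y → x ≠ z → y ≠ z →
        ∃ c : ℝ, e.factor x y = c * d.factor x y ∧ e.factor x z = c * d.factor x z ∧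
          e.factor y z = c * d.factor y z := by
      intro x y z hx hy hz hxy hxz hyz
      obtain ⟨c, -, h1, h2, h3⟩ := h.exists_pos (w := ω) (admissible_of_ne hxy hxz hyz)
      simp only [factor_remote hd hx, factor_remote hd hy, factor_remote hd hz,
        factor_remote he hx, factor_remote he hy, factor_remote he hz, mul_one, one_mul] at h1 h2 h3
      exact ⟨c, h1, h2, h3⟩
    have dpq := d.factor_pos hpq
    have l1 : ∀ x, x ≠ ω → x ≠ p → e.factor x p = e.factor p q / d.factor p q * d.factor x p := by
      intro x hx hxp
      by_cases hxq : x = q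
      · rw [hxq, factor_comm q p, factor_comm q p]
        field_simp
      · obtain ⟨c, h1, h2, h3⟩ := key x p q hx hp hq hxp hxq hpq
        rw [h1, h3]
        field_simp
    refine ⟨e.factor p q / d.factor p q, div_pos (e.factor_pos hpq) dpq, fun x y hx hy => ?_⟩
    by_cases hxy : x = y
    · rw [hxy, factor_self, factor_self, mul_zero]
    by_cases hxp : x = p
    · have hyp : y ≠ p := fun h => hxy (hxp.trans h.symm)
      rw [hxp, factor_comm p y, factor_comm p y, l1 y hy hyp]
    by_cases hyp : y = p
    · rw [hyp, l1 x hx hxp]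
    obtain ⟨c, h1, h2, h3⟩ := key x y p hx hy hp hxy hxp hyp
    rw [l1 x hx hxp] at h2
    rw [h1, ← mul_right_cancel₀ (d.factor_pos hxp).ne' h2]
  · push Not at hX
    exact ⟨1, one_pos, fun x y hx hy => by rw [hX x y hx hy, factor_self, factor_self, mul_zero]⟩

/-- The metric on the complement of the infinitely remote point. -/
@[reducible] noncomputable def metricSpace (d : ExtMetric X) (h : d.remote = some ω) :
    MetricSpace (Punctured X ω) where
  dist x y := d.factor x y
  dist_self x := d.factor_self _
  dist_comm x y := d.factor_comm _ _
  dist_triangle x y z := d.factor_triangle (remote_ne_of_ne h y.2) _ _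
  eq_of_dist_eq_zero {x y} hxy := Subtype.ext ((d.factor_eq_zero_iff _ _).1 hxy)

/-- The image of an extended metric under a bijection. -/
noncomputable def pullback (d : ExtMetric X) (φ : X → X) (hφ : Function.Bijective φ) :
    ExtMetric X where
  dist x y := d.dist (φ x) (φ y)
  remote := d.remote.map (Equiv.ofBijective φ hφ).symm
  dist_self x := d.dist_self _
  eq_of_dist_eq_zero x y h := hφ.1 (d.eq_of_dist_eq_zero _ _ h)
  dist_comm x y := d.dist_comm _ _
  dist_triangle x y z := d.dist_triangle _ _ _
  dist_eq_top_iff x y := by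
    have key : ∀ z, d.remote.map (Equiv.ofBijective φ hφ).symm = some z ↔
        d.remote = some (φ z) := by
      intro z
      rw [Option.map_eq_some_iff]
      constructor
      · rintro ⟨a, ha, rfl⟩
        rw [ha]
        exact congrArg some (Equiv.ofBijective_apply_symm_apply φ hφ a).symm
      · intro h
        exact ⟨φ z, h, Equiv.ofBijective_symm_apply_apply φ hφ z⟩
    rw [key, key, d.dist_eq_top_iff, hφ.1.ne_iff]

theorem pullback_remote {φ : X → X} (hφ : Function.Bijective φ) (h : d.remote = some (φ ω)) :
    (d.pullback φ hφ).remote = some ω := by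
  change d.remote.map _ = _
  rw [h]
  exact congrArg some (Equiv.ofBijective_symm_apply_apply φ hφ ω)

/-- The Ptolemy inequality for the factors. -/
def IsPtolemaic (d : ExtMetric X) : Prop :=
  ∀ x y z w : X, d.factor x z * d.factor y w ≤
    d.factor x y * d.factor z w + d.factor x w * d.factor y z

open Classical in
/-- The inversion of an extended metric at a point. -/
noncomputable def invert (d : ExtMetric X) (hd : d.IsPtolemaic) (p : X) : ExtMetric X where
  dist x y := if x = y then 0 else if x = p ∨ y = p then ∞ else
    ENNReal.ofReal (d.factor x y / (d.factor x p * d.factor y p))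
  remote := some p
  dist_self x := if_pos rfl
  eq_of_dist_eq_zero x y h := by
    by_contra hxy
    rw [if_neg hxy] at h
    by_cases h1 : x = p ∨ y = p
    · rw [if_pos h1] at h
      exact ENNReal.top_ne_zero h
    rw [if_neg h1] at h
    rw [not_or] at h1
    have h2 := d.factor_pos hxy
    have h3 := d.factor_pos h1.1
    have h4 := d.factor_pos h1.2
    have : 0 < d.factor x y / (d.factor x p * d.factor y p) := by positivity
    exact (ENNReal.ofReal_pos.2 this).ne' h
  dist_comm x y := by
    rw [d.factor_comm x y, mul_comm (d.factor x p)]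
    simp only [eq_comm (a := x) (b := y), or_comm (a := x = p)]
  dist_triangle x y z := by
    by_cases hxz : x = z
    · simp [hxz]
    by_cases hxy : x = y
    · simp [hxy]
    by_cases hyz : y = z
    · simp [hyz]
    rw [if_neg hxz, if_neg hxy, if_neg hyz]
    by_cases hx : x = p
    · simp [hx]
    by_cases hy : y = p
    · simp [hy]
    by_cases hz : z = p
    · simp [hz]
    rw [if_neg (by tauto), if_neg (by tauto), if_neg (by tauto),
      ← ENNReal.ofReal_add (div_nonneg (factor_nonneg _ _) (mul_nonneg (factor_nonneg _ _)
        (factor_nonneg _ _))) (div_nonneg (factor_nonneg _ _) (mul_nonneg (factor_nonneg _ _)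
        (factor_nonneg _ _)))]
    refine ENNReal.ofReal_le_ofReal ?_
    have h1 := d.factor_pos hx
    have h2 := d.factor_pos hy
    have h3 := d.factor_pos hz
    -- With denominators cleared, the triangle inequality is the Ptolemy inequality with fourth
    -- point `p`.
    have h4 := hd x y z p
    rw [div_add_div _ _ (by positivity) (by positivity),
      div_le_div_iff₀ (by positivity) (by positivity)]
    have := mul_le_mul_of_nonneg_left h4
      (by positivity : 0 ≤ d.factor x p * d.factor z p * d.factor y p)
    nlinarith
  dist_eq_top_iff x y := by
    by_cases hxy : x = y
    · simp [hxy]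
    · rw [if_neg hxy]
      have : ∀ x : X, some p = some x ↔ x = p := fun x => by rw [Option.some_inj, eq_comm]
      rw [this, this]
      by_cases h : x = p ∨ y = p
      · simp [h, hxy]
      · simp [h]

theorem invert_factor_of_ne (hd : d.IsPtolemaic) {p : X} (hx : x ≠ p) (hy : y ≠ p) :
    (d.invert hd p).factor x y = d.factor x y / (d.factor x p * d.factor y p) := by
  by_cases hxy : x = y
  · rw [hxy, factor_self, factor_self, zero_div]
  · have : (d.invert hd p).dist x y =
        ENNReal.ofReal (d.factor x y / (d.factor x p * d.factor y p)) := by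
      simp only [invert]
      rw [if_neg hxy, if_neg (by tauto)]
    rw [factor, this, if_neg ENNReal.ofReal_ne_top, ENNReal.toReal_ofReal]
    exact div_nonneg (factor_nonneg _ _) (mul_nonneg (factor_nonneg _ _) (factor_nonneg _ _))

/-- The two metrics differ by a weight `ρ x * ρ y`, and every entry of a cross-ratio triple contains
each of the four points once. -/
theorem moebiusEquiv_invert (hd : d.IsPtolemaic) (p : X) : d.MoebiusEquiv (d.invert hd p) := by
  classical
  let ρ : X → ℝ := fun x => if x = p then 1 else d.factor x p
  have hρ : ∀ x, 0 < ρ x := fun x => by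
    simp only [ρ]
    split_ifs with h
    · exact one_pos
    · exact d.factor_pos h
  have hf : ∀ x y, d.factor x y = ρ x * ρ y * (d.invert hd p).factor x y := fun x y => by
    by_cases hxy : x = y
    · rw [hxy, factor_self, factor_self, mul_zero]
    have hr : (d.invert hd p).remote = some p := rfl
    by_cases hx : x = p
    · subst hx
      simp only [ρ]
      rw [if_pos trivial, if_neg (Ne.symm hxy), factor_remote' hr (Ne.symm hxy), factor_comm]
      ring
    by_cases hy : y = p
    · subst hy
      simp only [ρ]
      rw [if_pos trivial, if_neg hxy, factor_remote hr hxy]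
      ring
    have h1 := d.factor_pos hx
    have h2 := d.factor_pos hy
    simp only [ρ]
    rw [if_neg hx, if_neg hy, invert_factor_of_ne hd hx hy]
    field_simp
  intro x y z w _
  refine ⟨ρ x * ρ y * ρ z * ρ w,
    (mul_pos (mul_pos (mul_pos (hρ x) (hρ y)) (hρ z)) (hρ w)).ne', ?_⟩
  funext i
  fin_cases i <;> simp only [crt, hf, Pi.smul_apply, smul_eq_mul, Fin.zero_eta, Fin.mk_one,
    Fin.reduceFinMk, Matrix.cons_val] <;> ring

/-! ### The Moebius topology. -/

section Nhds

theorem nhds_eq_comap (hx : d.remote ≠ some x) :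
    @nhds X d.topology x = comap (fun y => d.dist y x) (𝓝 0) := by
  let := d.topology
  refine le_antisymm ?_ ?_
  · rw [← tendsto_iff_comap, ENNReal.nhds_zero_basis.tendsto_right_iff]
    intro r hr
    obtain ⟨s, hs0, hsr⟩ : ∃ s : ℝ, 0 < s ∧ ENNReal.ofReal s ≤ r := by
      refine ⟨(min r 1).toReal, ENNReal.toReal_pos (by simp [hr.ne']) (by simp), ?_⟩
      rw [ENNReal.ofReal_toReal (by simp)]
      exact min_le_left _ _
    have ho : IsOpen {y | d.dist y x < ENNReal.ofReal s} :=
      TopologicalSpace.isOpen_generateFrom_of_mem (Or.inl ⟨x, s, hx, rfl⟩)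
    filter_upwards [ho.mem_nhds (by simpa [d.dist_self] using hs0)] with y hy
    exact lt_of_lt_of_le hy hsr
  · have ht : Tendsto (fun y => d.dist y x) (comap (fun y => d.dist y x) (𝓝 0)) (𝓝 0) :=
      tendsto_comap
    have : Tendsto (fun y : X => y) (comap (fun y => d.dist y x) (𝓝 0)) (𝓝 x) := by
      rw [TopologicalSpace.tendsto_nhds_generateFrom_iff]
      rintro _ (⟨z, r, hz, rfl⟩ | ⟨z, r, hz, rfl⟩) hmem
      · have h1 : d.dist x z < ENNReal.ofReal r := hmem
        have h2 : Tendsto (fun y => d.dist y x + d.dist x z)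
            (comap (fun y => d.dist y x) (𝓝 0)) (𝓝 (0 + d.dist x z)) := ht.add tendsto_const_nhds
        rw [zero_add] at h2
        filter_upwards [h2.eventually_lt_const h1] with y hy
        exact (d.dist_triangle y x z).trans_lt hy
      · have h1 : ENNReal.ofReal r < d.dist x z := not_le.1 hmem
        have h2 : Tendsto (fun y => d.dist y x + ENNReal.ofReal r)
            (comap (fun y => d.dist y x) (𝓝 0)) (𝓝 (0 + ENNReal.ofReal r)) :=
          ht.add tendsto_const_nhds
        rw [zero_add] at h2
        filter_upwards [h2.eventually_lt_const h1] with y hy hle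
        have h3 := d.dist_triangle x y z
        rw [d.dist_comm x y] at h3
        exact absurd (h3.trans (add_le_add_right hle _)) (not_le.2 hy)
    simpa [Tendsto] using this

theorem nhds_remote_eq_comap (h : d.remote = some ω) (ha : a ≠ ω) :
    @nhds X d.topology ω = comap (fun y => d.dist y a) (𝓝 ∞) := by
  let := d.topology
  have hω : d.dist ω a = ∞ := by rw [d.dist_comm, dist_remote h ha]
  refine le_antisymm ?_ ?_
  · rw [← tendsto_iff_comap, ENNReal.nhds_top_basis.tendsto_right_iff]
    intro r hr
    have ho : IsOpen {y | d.dist y a ≤ ENNReal.ofReal r.toReal}ᶜ :=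
      TopologicalSpace.isOpen_generateFrom_of_mem
        (Or.inr ⟨a, r.toReal, remote_ne_of_ne h ha, rfl⟩)
    filter_upwards [ho.mem_nhds (by simp [hω])] with y hy
    rw [ENNReal.ofReal_toReal hr.ne] at hy
    have hy' : ¬d.dist y a ≤ r := hy
    exact not_le.1 hy'
  · have ht : Tendsto (fun y => d.dist y a) (comap (fun y => d.dist y a) (𝓝 ∞)) (𝓝 ∞) :=
      tendsto_comap
    have : Tendsto (fun y : X => y) (comap (fun y => d.dist y a) (𝓝 ∞)) (𝓝 ω) := by
      rw [TopologicalSpace.tendsto_nhds_generateFrom_iff]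
      rintro _ (⟨z, r, hz, rfl⟩ | ⟨z, r, hz, rfl⟩) hmem
      · have h1 : d.dist ω z < ENNReal.ofReal r := hmem
        have hzω : z ≠ ω := fun h' => hz (h' ▸ h)
        rw [d.dist_comm, dist_remote h hzω] at h1
        exact absurd h1 not_top_lt
      · have hfin : ENNReal.ofReal r + d.dist z a < ∞ :=
          ENNReal.add_lt_top.2 ⟨ENNReal.ofReal_lt_top,
            (dist_ne_top hz (remote_ne_of_ne h ha)).lt_top⟩
        filter_upwards [ht.eventually_const_lt hfin] with y hy hle
        have h3 := d.dist_triangle y z a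
        exact absurd (h3.trans (add_le_add_left hle _)) (not_le.2 hy)
    simpa [Tendsto] using this

/-- Finiteness is required separately because the remote point has `factor` equal to `1`, which may
be less than `r`. -/
theorem mem_nhds_iff (hx : d.remote ≠ some x) {U : Set X} :
    U ∈ @nhds X d.topology x ↔ ∃ r : ℝ, 0 < r ∧ ∀ y, d.factor y x < r → d.dist y x ≠ ∞ → y ∈ U := by
  rw [nhds_eq_comap hx, (ENNReal.nhds_zero_basis.comap _).mem_iff]
  constructor
  · rintro ⟨r, hr, hU⟩
    refine ⟨(min r 1).toReal, ENNReal.toReal_pos (by simp [hr.ne']) (by simp), fun y hy hfin =>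
      hU ?_⟩
    change d.dist y x < r
    rw [← ofReal_factor hfin]
    refine lt_of_lt_of_le ((ENNReal.ofReal_lt_ofReal_iff_of_nonneg (factor_nonneg _ _)).2 hy) ?_
    rw [ENNReal.ofReal_toReal (by simp)]
    exact min_le_left _ _
  · rintro ⟨r, hr, hU⟩
    refine ⟨ENNReal.ofReal r, ENNReal.ofReal_pos.2 hr, fun y hy => ?_⟩
    have hy' : d.dist y x < ENNReal.ofReal r := hy
    have hfin : d.dist y x ≠ ∞ := (hy'.trans ENNReal.ofReal_lt_top).ne
    refine hU y ?_ hfin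
    rw [← ofReal_factor hfin] at hy'
    exact (ENNReal.ofReal_lt_ofReal_iff_of_nonneg (factor_nonneg _ _)).1 hy'

theorem mem_nhds_remote_iff (h : d.remote = some ω) (ha : a ≠ ω) {U : Set X} :
    U ∈ @nhds X d.topology ω ↔ ω ∈ U ∧ ∃ r : ℝ, ∀ y, y ≠ ω → r < d.factor y a → y ∈ U := by
  rw [nhds_remote_eq_comap h ha, (ENNReal.nhds_top_basis.comap _).mem_iff]
  have hω : d.dist ω a = ∞ := by rw [d.dist_comm, dist_remote h ha]
  constructor
  · rintro ⟨r, hr, hU⟩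
    refine ⟨hU (by change r < d.dist ω a; rwa [hω]), r.toReal, fun y hy hlt => hU ?_⟩
    change r < d.dist y a
    have hfin := dist_ne_top (remote_ne_of_ne h hy) (remote_ne_of_ne h ha)
    rw [← ofReal_factor hfin, ← ENNReal.ofReal_toReal hr.ne]
    exact (ENNReal.ofReal_lt_ofReal_iff_of_nonneg ENNReal.toReal_nonneg).2 hlt
  · rintro ⟨h0, r, hU⟩
    refine ⟨ENNReal.ofReal r, ENNReal.ofReal_lt_top, fun y hy => ?_⟩
    by_cases hyω : y = ω
    · rwa [hyω]
    refine hU y hyω ?_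
    have hy' : ENNReal.ofReal r < d.dist y a := hy
    have hfin := dist_ne_top (remote_ne_of_ne h hyω) (remote_ne_of_ne h ha)
    rw [← ofReal_factor hfin] at hy'
    exact (ENNReal.ofReal_lt_ofReal_iff'.1 hy').1

/-- A description of the neighborhoods in terms of cross-ratio triples. -/
theorem mem_nhds_iff_crt (hxa : x ≠ a) (hxb : x ≠ b) (hab : a ≠ b) {U : Set X} :
    U ∈ @nhds X d.topology x ↔ ∃ ε : ℝ, 0 < ε ∧ ∀ y,
      d.factor y x * d.factor a b < ε * (d.factor y a * d.factor x b) → y ∈ U := by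
  have hC := d.factor_pos hab
  have hA := d.factor_pos hxa
  have hB := d.factor_pos hxb
  by_cases hx : d.remote = some x
  · have key : ∀ y, y ≠ x → ∀ ε, (d.factor y x * d.factor a b < ε * (d.factor y a * d.factor x b) ↔
        d.factor a b < ε * d.factor y a) := fun y hy ε => by
      rw [factor_remote hx hy, factor_remote' hx hxb.symm, one_mul, mul_one]
    rw [mem_nhds_remote_iff hx hxa.symm]
    constructor
    · rintro ⟨h0, r, hU⟩
      refine ⟨d.factor a b / (|r| + 1), by positivity, fun y hy => ?_⟩
      by_cases hyx : y = x
      · rwa [hyx]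
      rw [key y hyx, div_mul_eq_mul_div, lt_div_iff₀ (by positivity)] at hy
      have := lt_of_mul_lt_mul_left hy hC.le
      exact hU y hyx (by linarith [le_abs_self r])
    · rintro ⟨ε, hε, hU⟩
      refine ⟨hU x (by rw [factor_self]; simp only [zero_mul]; positivity), d.factor a b / ε,
        fun y hyx hy => hU y ?_⟩
      rw [key y hyx]
      rw [div_lt_iff₀ hε] at hy
      linarith
  · rw [mem_nhds_iff hx]
    constructor
    · rintro ⟨r, hr, hU⟩
      -- The bound by `1` excludes the remote point. The next constant is chosen so that, with the
      -- triangle inequality through `x`, the cross-ratio condition gives `d.factor y x < s`.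
      have hs : 0 < min r 1 := lt_min hr one_pos
      set s := min r 1
      refine ⟨d.factor a b * s / (d.factor x b * (d.factor x a + s)), by positivity, fun y hy => ?_⟩
      have htri := factor_triangle hx y a
      have h1 : d.factor y x * (d.factor x a + s) < s * d.factor y a := by
        have e1 : d.factor a b * s / (d.factor x b * (d.factor x a + s)) *
            (d.factor y a * d.factor x b) =
            d.factor a b * (s * d.factor y a) / (d.factor x a + s) := by field_simp
        rw [e1, lt_div_iff₀ (by positivity)] at hy
        have : d.factor a b * (d.factor y x * (d.factor x a + s)) <
            d.factor a b * (s * d.factor y a) := by linarith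
        exact lt_of_mul_lt_mul_left this hC.le
      have h2 : d.factor y x < s := by
        have : d.factor x a * d.factor y x < d.factor x a * s := by nlinarith
        exact lt_of_mul_lt_mul_left this hA.le
      refine hU y (h2.trans_le (min_le_left _ _)) fun htop => ?_
      rw [factor, if_pos htop] at h2
      exact absurd (min_le_right r 1) (not_le.2 h2)
    · rintro ⟨ε, hε, hU⟩
      refine ⟨ε * d.factor x a * d.factor x b / (d.factor a b + ε * d.factor x b), by positivity,
        fun y hy hfin => hU y ?_⟩
      have hyr : d.remote ≠ some y := fun hyr => by
        by_cases hyx : y = x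
        · exact hx (hyx ▸ hyr)
        · exact hfin ((d.dist_eq_top_iff y x).2 ⟨hyx, Or.inl hyr⟩)
      have htri := factor_triangle hyr x a
      rw [factor_comm x y] at htri
      rw [lt_div_iff₀ (by positivity)] at hy
      have := mul_le_mul_of_nonneg_left htri (by positivity : 0 ≤ ε * d.factor x b)
      nlinarith

/-- Moebius equivalent metrics define the same topology. -/
theorem MoebiusEquiv.topology_eq (h : d.MoebiusEquiv e)
    (h3 : ∀ x : X, ∃ a b : X, x ≠ a ∧ x ≠ b ∧ a ≠ b) : d.topology = e.topology := by
  refine TopologicalSpace.ext_nhds fun x => ?_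
  obtain ⟨a, b, hxa, hxb, hab⟩ := h3 x
  ext U
  rw [mem_nhds_iff_crt hxa hxb hab, mem_nhds_iff_crt hxa hxb hab]
  refine exists_congr fun ε => and_congr_right fun hε => forall_congr' fun y => ?_
  have hadm : Admissible y x a b :=
    ⟨fun h => hxa h.2, fun h => hxb h.2, fun h => hab h.2, fun h => hxa h.1⟩
  obtain ⟨c, hc, h1, h2, -⟩ := h.exists_pos hadm
  rw [h1, h2, mul_left_comm ε c, mul_lt_mul_iff_of_pos_left hc]

end Nhds

end ExtMetric

/-! ### Topological circles as one-point compactified lines. -/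

theorem nonempty_onePoint_homeomorph_circle : Nonempty (OnePoint ℝ ≃ₜ Circle) := by
  have h1 : Module.finrank ℝ ℝ = Module.finrank ℝ (Submodule.span ℝ {(1 : ℂ)})ᗮ := by
    have : Fact (Module.finrank ℝ ℂ = 1 + 1) := ⟨Complex.finrank_real_complex⟩
    rw [Submodule.finrank_orthogonal_span_singleton (n := 1) one_ne_zero, Module.finrank_self]
  obtain ⟨e⟩ := FiniteDimensional.nonempty_continuousLinearEquiv_of_finrank_eq h1
  exact ⟨e.toHomeomorph.onePointCongr.trans
    (onePointHyperplaneHomeoUnitSphere (E := ℂ) (v := 1) norm_one)⟩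

/-- A line closed up by one point is a circle. -/
theorem nonempty_homeomorph_circle {X : Type*} [TopologicalSpace X] [T2Space X] {c : ℝ → X} {ω : X}
    (hc : Continuous c) (hinj : Function.Injective c) (hne : ∀ t, c t ≠ ω)
    (hlim : Tendsto c (cocompact ℝ) (𝓝 ω)) :
    Nonempty (↥(insert ω (Set.range c)) ≃ₜ Circle) := by
  let F : OnePoint ℝ → X := fun z => z.elim ω c
  have hF : Continuous F := by
    rw [OnePoint.continuous_iff]
    exact ⟨by rw [coclosedCompact_eq_cocompact]; exact hlim, hc⟩
  have hFinj : Function.Injective F := by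
    intro a b hab
    induction a using OnePoint.rec <;> induction b using OnePoint.rec
    · rfl
    · exact absurd hab.symm (hne _)
    · exact absurd hab (hne _)
    · exact congrArg _ (hinj hab)
  have hrange : Set.range F = insert ω (Set.range c) := by
    ext x
    constructor
    · rintro ⟨z, rfl⟩
      induction z using OnePoint.rec
      · exact Or.inl rfl
      · exact Or.inr ⟨_, rfl⟩
    · rintro (rfl | ⟨t, rfl⟩)
      · exact ⟨OnePoint.infty, rfl⟩
      · exact ⟨(t : OnePoint ℝ), rfl⟩
  obtain ⟨e⟩ := nonempty_onePoint_homeomorph_circle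
  rw [← hrange]
  exact ⟨(hF.isClosedEmbedding hFinj).isEmbedding.toHomeomorph.symm.trans e⟩

/-- A topological circle without a point is an embedded line. -/
theorem exists_isInducing_of_circle {X : Type*} [TopologicalSpace X] {σ : Set X}
    (h : Nonempty (σ ≃ₜ Circle)) {ω : X} (hω : ω ∈ σ) :
    ∃ k : ℝ → X, IsInducing k ∧ Function.Injective k ∧ (∀ t, k t ≠ ω) ∧
      σ = insert ω (Set.range k) ∧ Tendsto k (cocompact ℝ) (𝓝 ω) := by
  obtain ⟨e⟩ := nonempty_onePoint_homeomorph_circle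
  obtain ⟨h⟩ := h
  -- A rotation of the circle moves the point at infinity to `ω`.
  let H : OnePoint ℝ ≃ₜ σ :=
    (e.trans (Homeomorph.mulLeft (h ⟨ω, hω⟩ * (e OnePoint.infty)⁻¹))).trans h.symm
  have hH : H OnePoint.infty = ⟨ω, hω⟩ := by simp [H]
  refine ⟨fun t => (H t).1, ?_, ?_, ?_, ?_, ?_⟩
  · exact IsInducing.subtypeVal.comp (H.isInducing.comp OnePoint.isOpenEmbedding_coe.isInducing)
  · intro s t hst
    exact OnePoint.coe_injective (H.injective (Subtype.ext hst))
  · intro t ht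
    have : H t = H OnePoint.infty := by rw [hH]; exact Subtype.ext ht
    exact OnePoint.coe_ne_infty t (H.injective this)
  · ext x
    constructor
    · intro hx
      obtain ⟨z, hz⟩ := H.surjective ⟨x, hx⟩
      induction z using OnePoint.rec
      · left
        rw [hH] at hz
        exact (congrArg Subtype.val hz).symm
      · right
        exact ⟨_, congrArg Subtype.val hz⟩
    · rintro (rfl | ⟨t, rfl⟩)
      · exact hω
      · exact (H t).2
  · have h1 : Tendsto (fun z => (H z).1) (𝓝 OnePoint.infty) (𝓝 ω) := by
      have := (continuous_subtype_val.comp H.continuous).tendsto OnePoint.infty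
      simp only [Function.comp_def, hH] at this
      exact this
    have h2 := h1.comp (OnePoint.tendsto_coe_infty (X := ℝ))
    rwa [coclosedCompact_eq_cocompact] at h2

theorem infinite_of_homeomorph_circle {X : Type*} [TopologicalSpace X] {σ : Set X}
    (h : Nonempty (σ ≃ₜ Circle)) : σ.Infinite := by
  obtain ⟨e⟩ := nonempty_onePoint_homeomorph_circle
  obtain ⟨h⟩ := h
  have : Infinite (OnePoint ℝ) := Infinite.of_injective _ OnePoint.coe_injective
  exact Set.infinite_coe_iff.1 (Infinite.of_injective _ (e.trans h.symm).injective)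

/-! ### Geodesic lines in an extended metric. -/

namespace ExtMetric

variable {X : Type u} {d e : ExtMetric X} {ω x y : X} {c : ℝ → X}

/-- A geodesic line in the complement of `ω`. -/
structure IsLine (d : ExtMetric X) (ω : X) (c : ℝ → X) : Prop where
  ne : ∀ t, c t ≠ ω
  factor_eq : ∀ s t, d.factor (c s) (c t) = |s - t|

theorem IsLine.injective (hc : d.IsLine ω c) : Function.Injective c := fun s t h => by
  have := hc.factor_eq s t
  rw [h, factor_self] at this
  linarith [abs_eq_zero.1 this.symm]

theorem mem_nhds_iff_of_eq [t : TopologicalSpace X] (ht : t = d.topology)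
    (hx : d.remote ≠ some x) {U : Set X} :
    U ∈ 𝓝 x ↔ ∃ r : ℝ, 0 < r ∧ ∀ y, d.factor y x < r → d.dist y x ≠ ∞ → y ∈ U := by
  subst ht
  exact mem_nhds_iff hx

theorem mem_nhds_remote_iff_of_eq [t : TopologicalSpace X] (ht : t = d.topology)
    (h : d.remote = some ω) (hx : x ≠ ω) {U : Set X} :
    U ∈ 𝓝 ω ↔ ω ∈ U ∧ ∃ r : ℝ, ∀ y, y ≠ ω → r < d.factor y x → y ∈ U := by
  subst ht
  exact mem_nhds_remote_iff h hx

theorem IsLine.continuous [t : TopologicalSpace X] (ht : t = d.topology)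
    (h : d.remote = some ω) (hc : d.IsLine ω c) : Continuous c := by
  refine continuous_iff_continuousAt.2 fun s U hU => ?_
  obtain ⟨r, hr, hU⟩ := (mem_nhds_iff_of_eq ht (remote_ne_of_ne h (hc.ne s))).1 hU
  change ∀ᶠ t in 𝓝 s, c t ∈ U
  filter_upwards [Metric.ball_mem_nhds s hr] with t ht
  refine hU _ ?_ (dist_ne_top (remote_ne_of_ne h (hc.ne t)) (remote_ne_of_ne h (hc.ne s)))
  rw [hc.factor_eq, ← Real.dist_eq]
  exact ht

theorem IsLine.tendsto [t : TopologicalSpace X] (ht : t = d.topology)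
    (h : d.remote = some ω) (hc : d.IsLine ω c) : Tendsto c (cocompact ℝ) (𝓝 ω) := by
  intro U hU
  obtain ⟨-, r, hU⟩ := (mem_nhds_remote_iff_of_eq ht h (hc.ne 0)).1 hU
  change ∀ᶠ t in cocompact ℝ, c t ∈ U
  filter_upwards [(tendsto_norm_cocompact_atTop (E := ℝ)).eventually_gt_atTop r] with t ht
  refine hU _ (hc.ne t) ?_
  rw [hc.factor_eq, sub_zero]
  exact ht

theorem t2Space [t : TopologicalSpace X] (ht : t = d.topology) : T2Space X := by
  have hfin : ∀ x y : X, d.remote ≠ some x → x ≠ y → ∃ U ∈ 𝓝 x,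
      ∃ V ∈ 𝓝 y, Disjoint U V := by
    intro x y hx hxy
    by_cases hy : d.remote = some y
    · refine ⟨{z | d.factor z x < 1 ∧ d.dist z x ≠ ∞},
        (mem_nhds_iff_of_eq ht hx).2 ⟨1, one_pos, fun z hz hz' => ⟨hz, hz'⟩⟩,
        {z | z = y ∨ 1 < d.factor z x}, (mem_nhds_remote_iff_of_eq ht hy hxy).2
          ⟨Or.inl rfl, 1, fun z hz hz' => Or.inr hz'⟩, ?_⟩
      rw [Set.disjoint_left]
      rintro z ⟨hz, hz'⟩ (rfl | hz1)
      · exact hz' (by rw [d.dist_comm]; exact dist_remote hy hxy)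
      · linarith
    · have hp := d.factor_pos hxy
      refine ⟨{z | d.factor z x < d.factor x y / 2},
        (mem_nhds_iff_of_eq ht hx).2 ⟨d.factor x y / 2, by positivity, fun z hz _ => hz⟩,
        {z | d.factor z y < d.factor x y / 2 ∧ d.dist z y ≠ ∞},
        (mem_nhds_iff_of_eq ht hy).2
          ⟨d.factor x y / 2, by positivity, fun z hz hz' => ⟨hz, hz'⟩⟩, ?_⟩
      rw [Set.disjoint_left]
      rintro z hz ⟨hz1, hz2⟩
      have hz0 : d.factor z x < d.factor x y / 2 := hz
      have hzr : d.remote ≠ some z := fun hzr => by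
        by_cases hzy : z = y
        · exact hy (hzy ▸ hzr)
        · exact hz2 ((d.dist_eq_top_iff z y).2 ⟨hzy, Or.inl hzr⟩)
      have := factor_triangle hzr x y
      rw [factor_comm x z] at this
      linarith
  rw [t2Space_iff_disjoint_nhds]
  intro x y hxy
  rw [Filter.disjoint_iff]
  by_cases hx : d.remote = some x
  · obtain ⟨U, hU, V, hV, hUV⟩ := hfin y x (remote_ne_of_ne hx hxy.symm) hxy.symm
    exact ⟨V, hV, U, hU, hUV.symm⟩
  · exact hfin x y hx hxy

/-- A parametrized curve with additive distances can be parametrized as a line. -/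
theorem exists_isLine [t : TopologicalSpace X] (ht : t = d.topology) (h : d.remote = some ω)
    {k : ℝ → X} (hk : Continuous k) (hinj : Function.Injective k) (hne : ∀ t, k t ≠ ω)
    (hlim : Tendsto k (cocompact ℝ) (𝓝 ω))
    (hadd : ∀ a b c, a < b → b < c →
      d.factor (k a) (k c) = d.factor (k a) (k b) + d.factor (k b) (k c)) :
    ∃ c, d.IsLine ω c ∧ Set.range c = Set.range k := by
  -- Signed arc length from `k 0`. It tends to infinity at both ends because the curve approaches
  -- the remote point, so it is onto and its inverse gives the unit-speed parametrization.
  let G : ℝ → ℝ := fun t => if 0 ≤ t then d.factor (k 0) (k t) else -d.factor (k 0) (k t)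
  have hadd' : ∀ a b c, a ≤ b → b ≤ c →
      d.factor (k a) (k c) = d.factor (k a) (k b) + d.factor (k b) (k c) := by
    intro a b c hab hbc
    rcases hab.eq_or_lt with rfl | hab
    · rw [factor_self, zero_add]
    rcases hbc.eq_or_lt with rfl | hbc
    · rw [factor_self, add_zero]
    exact hadd a b c hab hbc
  have hG : ∀ s t, s ≤ t → G t - G s = d.factor (k s) (k t) := by
    intro s t hst
    simp only [G]
    split_ifs with h1 h2 h2
    · linarith [hadd' 0 s t h2 hst]
    · linarith [hadd' s 0 t (le_of_not_ge h2) h1, d.factor_comm (k s) (k 0)]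
    · exact absurd (h2.trans hst) h1
    · linarith [hadd' s t 0 hst (le_of_not_ge h1), d.factor_comm (k s) (k 0),
        d.factor_comm (k t) (k 0)]
  have hG' : ∀ s t, |G s - G t| = d.factor (k s) (k t) := by
    intro s t
    rcases le_total s t with hst | hst
    · rw [abs_sub_comm, hG s t hst, abs_of_nonneg (factor_nonneg _ _)]
    · rw [hG t s hst, abs_of_nonneg (factor_nonneg _ _), factor_comm]
  have hcont : Continuous G := by
    refine continuous_iff_continuousAt.2 fun s => ?_
    rw [ContinuousAt, Metric.tendsto_nhds]
    intro ε hε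
    have hmem : {y | d.factor y (k s) < ε} ∈ 𝓝 (k s) :=
      (mem_nhds_iff_of_eq ht (remote_ne_of_ne h (hne s))).2 ⟨ε, hε, fun y hy _ => hy⟩
    have := hk.continuousAt.eventually hmem
    filter_upwards [this] with t ht
    rw [Real.dist_eq, hG']
    exact ht
  have hlarge : ∀ r : ℝ, ∀ᶠ t in cocompact ℝ, r < d.factor (k t) (k 0) := fun r => by
    have hmem : {y | y = ω ∨ r < d.factor y (k 0)} ∈ 𝓝 ω :=
      (mem_nhds_remote_iff_of_eq ht h (hne 0)).2 ⟨Or.inl rfl, r, fun y hy hy' => Or.inr hy'⟩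
    have := hlim.eventually hmem
    filter_upwards [this] with t ht
    exact ht.resolve_left (hne t)
  have htop : Tendsto G atTop atTop := by
    refine tendsto_atTop.2 fun r => ?_
    filter_upwards [atTop_le_cocompact (hlarge r), eventually_ge_atTop 0] with t ht h0
    simp only [G, if_pos h0]
    rw [factor_comm]
    exact le_of_lt ht
  have hbot : Tendsto G atBot atBot := by
    refine tendsto_atBot.2 fun r => ?_
    filter_upwards [atBot_le_cocompact (hlarge (-r)), eventually_lt_atBot 0] with t ht h0
    have ht' : -r < d.factor (k t) (k 0) := ht
    simp only [G, if_neg (not_le.2 h0)]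
    rw [factor_comm]
    linarith
  have hsurj := hcont.surjective htop hbot
  have hGinj : Function.Injective G := fun s t hst => by
    have := hG' s t
    rw [hst, sub_self, abs_zero] at this
    exact hinj ((d.factor_eq_zero_iff _ _).1 this.symm)
  refine ⟨fun u => k (Function.surjInv hsurj u), ⟨fun t => hne _, fun s t => ?_⟩, ?_⟩
  · rw [← hG', Function.surjInv_eq hsurj, Function.surjInv_eq hsurj]
  · ext x
    constructor
    · rintro ⟨u, rfl⟩
      exact ⟨_, rfl⟩
    · rintro ⟨t, rfl⟩
      exact ⟨G t, congrArg k (hGinj (Function.surjInv_eq hsurj (G t)))⟩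

end ExtMetric

/-! ### Ptolemy circles correspond to geodesic lines. -/

namespace MoebiusStructure

open ExtMetric

variable {X : Type u} {M : MoebiusStructure X} {d e : ExtMetric X} {ω x y : X} {c : ℝ → X}

theorem moebiusEquiv (hd : d ∈ M.metrics) (he : e ∈ M.metrics) : d.MoebiusEquiv e :=
  (M.mem_iff d hd e).1 he

theorem IsPtolemy.isPtolemaic (hP : M.IsPtolemy) (hd : d ∈ M.metrics) : d.IsPtolemaic := by
  intro x y z w
  have n : ∀ x y, 0 ≤ d.factor x y := d.factor_nonneg
  by_cases hadm : Admissible x y z w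
  · exact (hP d hd x y z w hadm).2.1
  by_cases hxy : x = y
  · subst hxy
    simp [factor_self, mul_comm]
  by_cases hxz : x = z
  · subst hxz
    simp only [factor_self, zero_mul]
    have := mul_nonneg (n x y) (n x w)
    have := mul_nonneg (n x w) (n y x)
    linarith
  by_cases hyz : y = z
  · subst hyz
    simp [factor_self]
  exact absurd (admissible_of_ne hxy hxz hyz) hadm

theorem invert_mem (hP : M.IsPtolemy) (hd : d ∈ M.metrics) (p : X) :
    d.invert (hP.isPtolemaic hd) p ∈ M.metrics :=
  (M.mem_iff d hd _).2 (moebiusEquiv_invert _ p)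

theorem exists_remote (hP : M.IsPtolemy) (ω : X) : ∃ d ∈ M.metrics, d.remote = some ω := by
  obtain ⟨d, hd⟩ := M.nonempty
  exact ⟨_, invert_mem hP hd ω, rfl⟩

theorem IsAut.pullback_mem {φ : X → X} (hφ : M.IsAut φ) (hd : d ∈ M.metrics) :
    d.pullback φ hφ.bijective ∈ M.metrics :=
  (M.mem_iff d hd _).2 fun x y z w h => (hφ.crt_eq d hd x y z w h).symm

/-- Moebius automorphisms are similarities of punctured spaces. -/
theorem IsAut.exists_similarity {φ : X → X} (hφ : M.IsAut φ) (hd : d ∈ M.metrics)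
    (he : e ∈ M.metrics) (h : d.remote = some ω) (h' : e.remote = some (φ ω)) :
    ∃ l : ℝ, 0 < l ∧ ∀ x y, x ≠ ω → y ≠ ω → e.factor (φ x) (φ y) = l * d.factor x y :=
  (moebiusEquiv hd (hφ.pullback_mem he)).exists_scale h (pullback_remote hφ.bijective h')

theorem topology_eq (h3 : ∀ x : X, ∃ a b : X, x ≠ a ∧ x ≠ b ∧ a ≠ b) (hd : d ∈ M.metrics) :
    M.topology = d.topology :=
  (moebiusEquiv M.nonempty.some_mem hd).topology_eq h3

theorem exists_three_points (hE : M.PropertyE) (x : X) : ∃ a b : X, x ≠ a ∧ x ≠ b ∧ a ≠ b := by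
  classical
  obtain ⟨σ, hσ⟩ := hE
  let := M.topology
  have hinf := infinite_of_homeomorph_circle hσ.homeomorphic
  obtain ⟨a, -, ha⟩ := hinf.exists_notMem_finset {x}
  obtain ⟨b, -, hb⟩ := hinf.exists_notMem_finset {x, a}
  simp only [Finset.mem_singleton, Finset.mem_insert, not_or] at ha hb
  exact ⟨a, b, Ne.symm ha, Ne.symm hb.1, Ne.symm hb.2⟩

/-- A line closed up by the infinitely remote point is also a line with respect to any other of its
points. -/
theorem exists_line_rebase (hP : M.IsPtolemy) (hd : d ∈ M.metrics) (h : d.remote = some ω)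
    (hc : d.IsLine ω c) (p : ℝ) : ∃ e ∈ M.metrics, e.remote = some (c p) ∧
      ∃ c', e.IsLine (c p) c' ∧ insert (c p) (Set.range c') = insert ω (Set.range c) := by
  classical
  have hpt := hP.isPtolemaic hd
  -- Inversion at `c p` takes the reciprocal of the arc length measured from `p`; the old remote
  -- point fills the gap at `0`.
  let c' : ℝ → X := fun u => if u = 0 then ω else c (p - u⁻¹)
  have c0 : c' 0 = ω := if_pos rfl
  have cu : ∀ u, u ≠ 0 → c' u = c (p - u⁻¹) := fun u hu => if_neg hu
  have hne : ∀ u, u ≠ 0 → c (p - u⁻¹) ≠ c p := fun u hu h => by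
    have := hc.injective h
    exact inv_ne_zero hu (by linarith)
  have hf : ∀ u, u ≠ 0 → d.factor (c (p - u⁻¹)) (c p) = |u|⁻¹ := fun u hu => by
    rw [hc.factor_eq, sub_sub_cancel_left, abs_neg, abs_inv]
  have hω : ω ≠ c p := (hc.ne p).symm
  have hf0 : ∀ u, u ≠ 0 → (d.invert hpt (c p)).factor ω (c (p - u⁻¹)) = |u| := fun u hu => by
    rw [invert_factor_of_ne hpt hω (hne u hu), factor_remote' h (hc.ne _),
      factor_remote' h (hc.ne _), hf u hu, one_mul, one_div, inv_inv]
  refine ⟨_, invert_mem hP hd (c p), rfl, c', ⟨fun u => ?_, fun u v => ?_⟩, ?_⟩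
  · by_cases hu : u = 0
    · rw [hu, c0]
      exact hω
    · rw [cu u hu]
      exact hne u hu
  · by_cases hu : u = 0 <;> by_cases hv : v = 0
    · rw [hu, hv, factor_self, sub_self, abs_zero]
    · rw [hu, c0, cu v hv, hf0 v hv, zero_sub, abs_neg]
    · rw [hv, c0, cu u hu, factor_comm, hf0 u hu, sub_zero]
    · rw [cu u hu, cu v hv, invert_factor_of_ne hpt (hne u hu) (hne v hv), hf u hu, hf v hv,
        hc.factor_eq, ← mul_inv, div_inv_eq_mul, ← abs_mul, ← abs_mul]
      congr 1
      field_simp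
      ring
  · ext x
    simp only [Set.mem_insert_iff, Set.mem_range]
    constructor
    · rintro (rfl | ⟨u, rfl⟩)
      · exact Or.inr ⟨p, rfl⟩
      · by_cases hu : u = 0
        · left
          rw [hu, c0]
        · right
          exact ⟨_, (cu u hu).symm⟩
    · rintro (rfl | ⟨t, rfl⟩)
      · exact Or.inr ⟨0, c0⟩
      · by_cases ht : t = p
        · exact Or.inl (by rw [ht])
        · right
          have : p - t ≠ 0 := sub_ne_zero.2 (Ne.symm ht)
          refine ⟨(p - t)⁻¹, ?_⟩
          rw [cu _ (inv_ne_zero this), inv_inv, sub_sub_cancel]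

theorem factor_eq_of_mem (hd : d ∈ M.metrics) (he : e ∈ M.metrics) {x y z w : X}
    (hxy : x ≠ y) (hxz : x ≠ z) (hyz : y ≠ z)
    (h : d.factor x z * d.factor y w = d.factor x y * d.factor z w + d.factor x w * d.factor y z) :
    e.factor x z * e.factor y w = e.factor x y * e.factor z w + e.factor x w * e.factor y z := by
  obtain ⟨k, -, h1, h2, h3⟩ :=
    (moebiusEquiv hd he).exists_pos (w := w) (admissible_of_ne hxy hxz hyz)
  rw [h1, h2, h3, h]
  ring

/-- A line closed up by the infinitely remote point is a Ptolemy circle. -/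
theorem isPtolemyCircle_of_isLine (hP : M.IsPtolemy)
    (h3 : ∀ x : X, ∃ a b : X, x ≠ a ∧ x ≠ b ∧ a ≠ b) (hd : d ∈ M.metrics)
    (h : d.remote = some ω) (hc : d.IsLine ω c) : M.IsPtolemyCircle (insert ω (Set.range c)) := by
  have ht := topology_eq h3 hd
  let := M.topology
  have := t2Space ht
  refine ⟨nonempty_homeomorph_circle (hc.continuous ht h) hc.injective hc.ne (hc.tendsto ht h), ?_⟩
  intro x hx y hy z hz w hw hxy hxz hxw hyz hyw hzw hcomp d' hd'
  -- With `x` made remote, the Ptolemy equality becomes additivity of distances on a line, and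
  -- separation of `y` from `w` places `z` between them.
  obtain ⟨e, he, her, c', hc', hr⟩ : ∃ e ∈ M.metrics, e.remote = some x ∧
      ∃ c', e.IsLine x c' ∧ insert x (Set.range c') = insert ω (Set.range c) := by
    rcases hx with rfl | ⟨p, rfl⟩
    · exact ⟨d, hd, h, c, hc, rfl⟩
    · exact exists_line_rebase hP hd h hc p
  rw [← hr] at hy hz hw hcomp
  obtain ⟨s, rfl⟩ := hy.resolve_left hxy.symm
  obtain ⟨q, rfl⟩ := hz.resolve_left hxz.symm
  obtain ⟨t, rfl⟩ := hw.resolve_left hxw.symm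
  refine factor_eq_of_mem he hd' hxy hxz hyz ?_
  rw [factor_remote' her (hc'.ne _), factor_remote' her (hc'.ne _), factor_remote' her (hc'.ne _),
    hc'.factor_eq, hc'.factor_eq, hc'.factor_eq, one_mul, one_mul, one_mul]
  have hq : q ∈ Set.uIcc s t := by
    by_contra hq
    refine hcomp ?_
    have hpre : IsPreconnected (c' '' Set.uIcc s t) :=
      isPreconnected_uIcc.image _ (hc'.continuous (topology_eq h3 he) her).continuousOn
    have hsub := hpre.subset_connectedComponentIn (F := insert x (Set.range c') \ {x, c' q})
      (Set.mem_image_of_mem _ Set.left_mem_uIcc) (by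
        rintro _ ⟨u, hu, rfl⟩
        refine ⟨Or.inr ⟨u, rfl⟩, ?_⟩
        rintro (h' | h')
        · exact hc'.ne u h'
        · exact hq (hc'.injective h' ▸ hu))
    exact connectedComponentIn_eq (hsub (Set.mem_image_of_mem _ Set.right_mem_uIcc))
  rcases Set.mem_uIcc.1 hq with ⟨h1, h2⟩ | ⟨h1, h2⟩
  · rw [abs_sub_comm s t, abs_of_nonneg (by linarith : 0 ≤ t - s), abs_sub_comm q t,
      abs_of_nonneg (by linarith : 0 ≤ t - q), abs_sub_comm s q,
      abs_of_nonneg (by linarith : 0 ≤ q - s)]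
    ring
  · rw [abs_of_nonneg (by linarith : 0 ≤ s - t), abs_of_nonneg (by linarith : 0 ≤ q - t),
      abs_of_nonneg (by linarith : 0 ≤ s - q)]
    ring

/-- A Ptolemy circle is a line closed up by the infinitely remote point. -/
theorem IsPtolemyCircle.exists_isLine (h3 : ∀ x : X, ∃ a b : X, x ≠ a ∧ x ≠ b ∧ a ≠ b)
    (hd : d ∈ M.metrics) (h : d.remote = some ω) {σ : Set X} (hσ : M.IsPtolemyCircle σ)
    (hω : ω ∈ σ) : ∃ c, d.IsLine ω c ∧ σ = insert ω (Set.range c) := by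
  have ht := topology_eq h3 hd
  let := M.topology
  obtain ⟨k, hind, hinj, hne, rfl, hlim⟩ := exists_isInducing_of_circle hσ.homeomorphic hω
  obtain ⟨c, hc, hr⟩ := ExtMetric.exists_isLine ht h hind.continuous hinj hne hlim (by
    intro a b c hab hbc
    have hpt := hσ.ptolemy_eq ω hω (k a) (Or.inr ⟨a, rfl⟩) (k b) (Or.inr ⟨b, rfl⟩)
      (k c) (Or.inr ⟨c, rfl⟩) (hne a).symm (hne b).symm (hne c).symm (hinj.ne hab.ne)
      (hinj.ne (hab.trans hbc).ne) (hinj.ne hbc.ne) (by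
        intro heq
        set F := insert ω (Set.range k) \ {ω, k b}
        have mem : ∀ t, t ≠ b → k t ∈ F := fun t htb => ⟨Or.inr ⟨t, rfl⟩, by
          rintro (h' | h')
          · exact hne t h'
          · exact htb (hinj h')⟩
        have hsub := connectedComponentIn_subset F (k a)
        have ha : k a ∈ connectedComponentIn F (k a) := mem_connectedComponentIn (mem a hab.ne)
        have hcm : k c ∈ connectedComponentIn F (k a) := by
          rw [heq]
          exact mem_connectedComponentIn (mem c hbc.ne')
        have himg : k '' (k ⁻¹' connectedComponentIn F (k a)) = connectedComponentIn F (k a) := by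
          rw [Set.image_preimage_eq_iff]
          intro x hx
          have hx' := hsub hx
          exact hx'.1.resolve_left fun h' => hx'.2 (Or.inl h')
        -- If `k a` and `k c` shared a component, its preimage would be an interval containing `b`,
        -- although `k b` was removed.
        have hpre : IsPreconnected (k ⁻¹' connectedComponentIn F (k a)) := by
          rw [← hind.isPreconnected_image, himg]
          exact isPreconnected_connectedComponentIn
        have hb : b ∈ k ⁻¹' connectedComponentIn F (k a) :=
          hpre.ordConnected.out ha hcm ⟨hab.le, hbc.le⟩
        exact (hsub hb).2 (Or.inr rfl)) d hd
    rw [factor_remote' h (hne _), factor_remote' h (hne _), factor_remote' h (hne _)] at hpt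
    linarith)
  exact ⟨c, hc, by rw [hr]⟩

end MoebiusStructure

/-! ### Effect of similarities on the base. -/

section Base

variable {Y : Type*} [MetricSpace Y] {c c' : ℝ → Y}

theorem exists_reparametrization (hc : Isometry c) {x z : Y} (hx : x ∈ Set.range c)
    (hz : z ∈ Set.range c) (hxz : x ≠ z) :
    ∃ c' : ℝ → Y, Isometry c' ∧ Set.range c' = Set.range c ∧ c' 0 = x ∧ ∃ p, 0 < p ∧ c' p = z := by
  obtain ⟨s, rfl⟩ := hx
  obtain ⟨t, rfl⟩ := hz
  have hst : s ≠ t := fun h => hxz (congrArg c h)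
  rcases lt_or_gt_of_ne hst with h | h
  · refine ⟨fun u => c (u + s), isometry_comp_add hc s, ?_, by simp, t - s, by linarith, by simp⟩
    exact (add_right_surjective s).range_comp c
  · refine ⟨fun u => c (-u + s), isometry_comp_neg (isometry_comp_add hc s), ?_, by simp, s - t,
      by linarith, by simp⟩
    exact ((add_right_surjective s).comp neg_surjective).range_comp c

/-- Two lines from a point to the same fiber coincide. -/
theorem line_eq_of_busemannMap_eq [InversiveSpace Y] [ProperSpace Y] (hc : Isometry c)
    (hc' : Isometry c') (h0 : c 0 = c' 0) {p q : ℝ} (hp : 0 < p) (hq : 0 < q)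
    (h : ∀ e, Isometry e → busemann e (c p) = busemann e (c' q)) : c = c' := by
  have key : ∀ (c c' : ℝ → Y), Isometry c → Isometry c' → c 0 = c' 0 → ∀ p q : ℝ, 0 < q →
      busemann c (c p) = busemann c (c' q) → p ≤ q := by
    intro c c' hc hc' h0 p q hq h
    have h1 := busemann_sub_le hc (c' q) (c' 0)
    rw [← h, busemann_line hc, ← h0, busemann_line hc, h0, hc'.dist_eq, Real.dist_eq, sub_zero,
      sub_zero, abs_of_pos hq] at h1
    exact h1
  obtain rfl : p = q := le_antisymm (key c c' hc hc' h0 p q hq (h c hc))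
    (key c' c hc' hc h0.symm q p hp (h c' hc').symm)
  exact line_eq_of_busemann hc hc' h0 hp ((h c hc).symm.trans (busemann_line hc p))

/-- A Busemann function that realizes the base distance is carried to a competitor for the maximum
in the target. Applied to the inverse of `h` as well, this gives equality. -/
theorem mul_dist_le_of_similarity {Y' B B' : Type*} [MetricSpace Y'] [MetricSpace B]
    [MetricSpace B'] {π : Y → B} {π' : Y' → B'}
    (hπ : ∀ x y, IsGreatest {r | ∃ c, Isometry c ∧ r = busemann c x - busemann c y}
      (dist (π x) (π y)))
    (hπ' : ∀ x y, IsGreatest {r | ∃ c, Isometry c ∧ r = busemann c x - busemann c y}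
      (dist (π' x) (π' y))) {h : Y → Y'} {l : ℝ} (hl : 0 < l)
    (hd : ∀ x y, dist (h x) (h y) = l * dist x y) (x y : Y) :
    l * dist (π x) (π y) ≤ dist (π' (h x)) (π' (h y)) := by
  obtain ⟨c, hc, hcd⟩ := (hπ x y).1
  refine (hπ' (h x) (h y)).2 ⟨_, isometry_similarity hl hd hc, ?_⟩
  rw [busemann_similarity hl hd hc, busemann_similarity hl hd hc, hcd]
  ring

theorem dist_eq_of_similarity {Y' B B' : Type*} [MetricSpace Y'] [MetricSpace B]
    [MetricSpace B'] {π : Y → B} {π' : Y' → B'}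
    (hπ : ∀ x y, IsGreatest {r | ∃ c, Isometry c ∧ r = busemann c x - busemann c y}
      (dist (π x) (π y)))
    (hπ' : ∀ x y, IsGreatest {r | ∃ c, Isometry c ∧ r = busemann c x - busemann c y}
      (dist (π' x) (π' y))) {h : Y → Y'} (hs : Function.Surjective h) {l : ℝ} (hl : 0 < l)
    (hd : ∀ x y, dist (h x) (h y) = l * dist x y) (x y : Y) :
    dist (π' (h x)) (π' (h y)) = l * dist (π x) (π y) := by
  have hinj : Function.Injective h := fun x y hxy => by
    have := hd x y
    rw [hxy, dist_self] at this
    exact dist_eq_zero.1 ((mul_eq_zero.1 this.symm).resolve_left hl.ne')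
  have hg : ∀ z, Function.surjInv hs (h z) = z := fun z => hinj (Function.surjInv_eq hs (h z))
  refine le_antisymm ?_ (mul_dist_le_of_similarity hπ hπ' hl hd x y)
  have := mul_dist_le_of_similarity hπ' hπ (h := Function.surjInv hs) (inv_pos.2 hl) (fun a b => by
    rw [← mul_right_inj' hl.ne', ← hd, Function.surjInv_eq hs, Function.surjInv_eq hs, ← mul_assoc,
      mul_inv_cancel₀ hl.ne', one_mul]) (h x) (h y)
  rw [hg, hg, inv_mul_le_iff₀ hl] at this
  exact this

theorem exists_dilationEquiv {Z Z' B B' : Type*} [MetricSpace B] [MetricSpace B'] {π : Z → B}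
    {π' : Z' → B'} (hπ : Function.Surjective π) (hπ' : Function.Surjective π') {h : Z → Z'}
    (hs : Function.Surjective h) {l : ℝ} (hl : 0 < l)
    (hd : ∀ x y, dist (π' (h x)) (π' (h y)) = l * dist (π x) (π y)) :
    ∃ f : B ≃ᵈ B', ∀ x, π' (h x) = f (π x) := by
  let f : B → B' := fun b => π' (h (Function.surjInv hπ b))
  have hf : ∀ a b, dist (f a) (f b) = l * dist a b := fun a b => by
    simp only [f, hd, Function.surjInv_eq hπ]
  have hcomm : ∀ x, π' (h x) = f (π x) := fun x => by
    rw [← dist_eq_zero]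
    simp only [f, hd, Function.surjInv_eq hπ, dist_self, mul_zero]
  have hbij : Function.Bijective f := by
    constructor
    · intro a b hab
      have := hf a b
      rw [hab, dist_self] at this
      exact dist_eq_zero.1 ((mul_eq_zero.1 this.symm).resolve_left hl.ne')
    · intro b
      obtain ⟨z, rfl⟩ := hπ' b
      obtain ⟨x, rfl⟩ := hs z
      exact ⟨π x, (hcomm x).symm⟩
  refine ⟨{ Equiv.ofBijective f hbij with
    edist_eq' := ⟨l.toNNReal, (Real.toNNReal_pos.2 hl).ne', fun a b => ?_⟩ }, hcomm⟩
  change edist (f a) (f b) = _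
  rw [edist_dist, edist_dist, hf, ENNReal.ofReal_mul hl.le]
  rfl

end Base

/-! ### The punctured space as a proper metric space. -/

namespace ExtMetric

variable {X : Type u} {d : ExtMetric X} {ω : X}

theorem IsLine.isometry (h : d.remote = some ω) {c : ℝ → X} (hc : d.IsLine ω c) :
    letI := d.metricSpace h
    Isometry fun t => (⟨c t, hc.ne t⟩ : Punctured X ω) :=
  letI := d.metricSpace h
  Isometry.of_dist_eq fun s t => hc.factor_eq s t

theorem isLine_of_isometry (h : d.remote = some ω) {c : ℝ → Punctured X ω}
    (hc : letI := d.metricSpace h; Isometry c) : d.IsLine ω fun t => (c t).1 :=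
  ⟨fun t => (c t).2, fun s t => letI := d.metricSpace h; hc.dist_eq s t⟩

/-- An ultrafilter on a closed ball converges in the compact space `X`, and its limit is not `ω`,
since `ω` has a neighborhood disjoint from the ball. -/
theorem properSpace (h : d.remote = some ω) (hcompact : @CompactSpace X d.topology) :
    letI := d.metricSpace h
    ProperSpace (Punctured X ω) := by
  have hlim : ∀ f : Ultrafilter X, ∃ x, (f : Filter X) ≤ @nhds X d.topology x := fun f => by
    let := d.topology
    obtain ⟨x, -, hx⟩ := isCompact_univ.ultrafilter_le_nhds f (by simp)
    exact ⟨x, hx⟩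
  let := d.metricSpace h
  refine ⟨fun x r => isCompact_iff_ultrafilter_le_nhds.2 fun f hf => ?_⟩
  obtain ⟨z, hz⟩ := hlim (f.map Subtype.val)
  have hzω : z ≠ ω := by
    rintro rfl
    have hU : {y | y = z ∨ r < d.factor y x} ∈ @nhds X d.topology z :=
      (mem_nhds_remote_iff h x.2).2 ⟨Or.inl rfl, r, fun y _ hy => Or.inr hy⟩
    have h1 : Subtype.val ⁻¹' {y | y = z ∨ r < d.factor y x} ∈ f := hz hU
    obtain ⟨y, hy1, hy2⟩ := f.nonempty_of_mem (inter_mem h1 (le_principal_iff.1 hf))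
    rcases hy1 with hy1 | hy1
    · exact y.2 hy1
    · exact absurd (Metric.mem_closedBall.1 hy2) (not_le.2 hy1)
  have hfz : (f : Filter (Punctured X ω)) ≤ 𝓝 ⟨z, hzω⟩ := by
    refine Metric.nhds_basis_ball.ge_iff.2 fun ε hε => ?_
    have hU : {y | d.factor y z < ε} ∈ @nhds X d.topology z :=
      (mem_nhds_iff (remote_ne_of_ne h hzω)).2 ⟨ε, hε, fun y hy _ => hy⟩
    exact hz hU
  refine ⟨⟨z, hzω⟩, ?_, hfz⟩
  exact Metric.isClosed_closedBall.mem_of_tendsto (f := id) (b := (f : Filter (Punctured X ω)))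
    hfz (le_principal_iff.1 hf)

end ExtMetric

/-! ### Space inversions act as metric inversions. -/

namespace MoebiusStructure

open ExtMetric

variable {X : Type u} {M : MoebiusStructure X} {d e : ExtMetric X} {ω p : X}

theorem isSphere_of_ne {x : X} (h1 : x ≠ ω) (h2 : x ≠ p) :
    M.IsSphere ω p {y | y ≠ ω ∧ y ≠ p ∧ ∀ d ∈ M.metrics, d.crt ω x y p 0 = d.crt ω x y p 1} :=
  ⟨x, h1, h2, rfl⟩

/-- A space inversion is a metric inversion in the space punctured at its base point. -/
theorem IsSpaceInversion.factor_eq (hP : M.IsPtolemy) (hd : d ∈ M.metrics)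
    (h : d.remote = some ω) (hp : p ≠ ω) {x₀ : X} (h1 : x₀ ≠ ω) (h2 : x₀ ≠ p) {φ : X → X}
    (hφ : M.IsSpaceInversion ω p
      {y | y ≠ ω ∧ y ≠ p ∧ ∀ d ∈ M.metrics, d.crt ω x₀ y p 0 = d.crt ω x₀ y p 1} φ) :
    φ p = ω ∧ (∀ x y, x ≠ ω → y ≠ ω → x ≠ p → y ≠ p → d.factor (φ x) (φ y) =
      d.factor x₀ p ^ 2 * d.factor x y / (d.factor x p * d.factor y p)) ∧
      ∀ x, x ≠ ω → x ≠ p → d.factor (φ x) p = d.factor x₀ p ^ 2 / d.factor x p := by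
  have hpω : φ p = ω := by rw [← hφ.map_base, hφ.involutive]
  obtain ⟨l, hl, hsim⟩ := hφ.isAut.exists_similarity (invert_mem hP hd p) hd
    (ω := p) rfl (by rw [hpω, h])
  have hpt := hP.isPtolemaic hd
  have e1 : ∀ x y, x ≠ p → y ≠ p → d.factor (φ x) (φ y) =
      l * (d.factor x y / (d.factor x p * d.factor y p)) := fun x y hx hy => by
    rw [hsim x y hx hy, invert_factor_of_ne hpt hx hy]
  have e2 : ∀ x, x ≠ ω → x ≠ p → d.factor (φ x) p = l / d.factor x p := fun x hx hxp => by
    have := e1 x ω hxp hp.symm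
    rw [hφ.map_base, factor_remote h hx, factor_remote' h hp] at this
    rw [this]
    ring
  -- With `ω` remote, the sphere is a metric sphere around `p`. As `φ` preserves it, the similarity
  -- ratio must be the squared radius.
  have e3 : d.factor (φ x₀) p = d.factor x₀ p := by
    have hmem : φ x₀ ∈ φ '' {y | y ≠ ω ∧ y ≠ p ∧ ∀ d ∈ M.metrics,
        d.crt ω x₀ y p 0 = d.crt ω x₀ y p 1} :=
      Set.mem_image_of_mem _ ⟨h1, h2, fun d _ => by simp [crt]⟩
    rw [hφ.map_sphere] at hmem
    have := hmem.2.2 d hd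
    simp only [crt, Matrix.cons_val] at this
    rwa [factor_remote' h h1, factor_remote' h hmem.1, one_mul, one_mul] at this
  have e4 : l = d.factor x₀ p ^ 2 := by
    have := e2 x₀ h1 h2
    rw [e3, eq_div_iff (d.factor_pos h2).ne'] at this
    rw [← this, sq]
  refine ⟨hpω, fun x y _ _ hx hy => ?_, fun x hx hxp => ?_⟩
  · rw [e1 x y hx hy, e4, mul_div_assoc]
  · rw [e2 x hx hxp, e4]

/-- The given circle may miss `ω`. It yields a line in the space punctured at one of its points `p`,
and a space inversion exchanging `p` and `ω` transports that line. -/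
theorem exists_line_punctured (hP : M.IsPtolemy) (hE : M.PropertyE) (hI : M.PropertyI)
    (hd : d ∈ M.metrics) (h : d.remote = some ω) : ∃ c, d.IsLine ω c := by
  have h3 := exists_three_points hE
  obtain ⟨σ, hσ⟩ := hE
  obtain ⟨p, hp⟩ : σ.Nonempty := by
    let := M.topology
    exact (infinite_of_homeomorph_circle hσ.homeomorphic).nonempty
  by_cases hpω : p = ω
  · obtain ⟨c, hc, -⟩ := hσ.exists_isLine h3 hd h (hpω ▸ hp)
    exact ⟨c, hc⟩
  obtain ⟨e, he, her⟩ := exists_remote hP p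
  obtain ⟨c, hc, -⟩ := hσ.exists_isLine h3 he her hp
  obtain ⟨x, hxp, hxω⟩ : ∃ x, x ≠ p ∧ x ≠ ω := by
    obtain ⟨a, b, h1, h2, h3⟩ := h3 p
    by_cases ha : a = ω
    · exact ⟨b, h2.symm, fun hb => h3 (ha.trans hb.symm)⟩
    · exact ⟨a, h1.symm, ha⟩
  obtain ⟨φ, hφ, -⟩ := hI p ω hpω _ (isSphere_of_ne hxp hxω)
  obtain ⟨l, hl, hsim⟩ := hφ.isAut.exists_similarity he hd her (by rw [hφ.map_base, h])
  refine ⟨fun t => φ (c (t / l)), fun t ht => ?_, fun s t => ?_⟩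
  · rw [← hφ.map_base] at ht
    exact hc.ne _ (hφ.isAut.bijective.injective ht)
  · rw [hsim _ _ (hc.ne _) (hc.ne _), hc.factor_eq, ← sub_div, abs_div, abs_of_pos hl]
    field_simp

/-- Invariance of the circle and the distance to the center leave two candidates for `φ (c t)`.
Absence of fixed points settles the sign at parameters `r` and `-r`, and comparing distances with
one of these points settles it for all `t`. -/
theorem IsSpaceInversion.isLine_apply (hP : M.IsPtolemy)
    (h3 : ∀ x : X, ∃ a b : X, x ≠ a ∧ x ≠ b ∧ a ≠ b) (hd : d ∈ M.metrics)
    (h : d.remote = some ω) {x₀ : X} {c : ℝ → X} (hc : d.IsLine ω c)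
    (h1 : x₀ ≠ ω) (h2 : x₀ ≠ c 0) {φ : X → X}
    (hφ : M.IsSpaceInversion ω (c 0)
      {y | y ≠ ω ∧ y ≠ c 0 ∧ ∀ d ∈ M.metrics, d.crt ω x₀ y (c 0) 0 = d.crt ω x₀ y (c 0) 1} φ)
    {t : ℝ} (ht : t ≠ 0) : φ (c t) = c (-(d.factor x₀ (c 0) ^ 2 / t)) := by
  obtain ⟨h0, hdist, hcenter⟩ := hφ.factor_eq hP hd h (hc.ne 0) h1 h2
  set r := d.factor x₀ (c 0)
  have hr : 0 < r := d.factor_pos h2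
  have hne : ∀ s : ℝ, s ≠ 0 → c s ≠ c 0 := fun s hs h => hs (hc.injective h)
  have hσ := isPtolemyCircle_of_isLine hP h3 hd h hc
  have himg := hφ.map_circle _ hσ (Or.inl rfl) (Or.inr ⟨0, rfl⟩)
  have cases : ∀ s : ℝ, s ≠ 0 → φ (c s) = c (r ^ 2 / s) ∨ φ (c s) = c (-(r ^ 2 / s)) := by
    intro s hs
    have hmem : φ (c s) ∈ insert ω (Set.range c) := by
      rw [← himg]
      exact Set.mem_image_of_mem _ (Or.inr ⟨s, rfl⟩)
    obtain ⟨u, hu⟩ := hmem.resolve_left fun hω => hne s hs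
      (hφ.isAut.bijective.injective (hω.trans h0.symm))
    have hcs := hcenter (c s) (hc.ne s) (hne s hs)
    rw [← hu, hc.factor_eq, hc.factor_eq, sub_zero, sub_zero] at hcs
    have : |u| = |r ^ 2 / s| := by rw [hcs, abs_div, abs_of_pos (pow_pos hr 2)]
    rw [← hu]
    rcases abs_eq_abs.1 this with h | h
    · exact Or.inl (congrArg c h)
    · exact Or.inr (congrArg c h)
  have hplus : φ (c r) = c (-r) := by
    have := cases r hr.ne'
    rw [show r ^ 2 / r = r by field_simp] at this
    exact this.resolve_left (hφ.fixedPointFree _)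
  have hminus : φ (c (-r)) = c r := by rw [← hplus, hφ.involutive]
  refine (cases t ht).resolve_left fun hbad => ?_
  -- The wrong sign at `t` would give `|s + t| = |t - s|`, impossible for `s` and `t` of the same
  -- sign.
  have hkey : ∀ s : ℝ, s ≠ 0 → 0 < s * t → φ (c s) = c (-s) → |s| = r → False := by
    intro s hs hst hφs habs
    have hfd := hdist (c t) (c s) (hc.ne t) (hc.ne s) (hne t ht) (hne s hs)
    rw [hbad, hφs] at hfd
    simp only [hc.factor_eq, sub_zero] at hfd
    have hs2 : r ^ 2 = s ^ 2 := by rw [← habs, sq_abs]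
    rw [hs2, ← abs_mul, mul_comm t s, abs_of_pos hst, sub_neg_eq_add, eq_div_iff hst.ne'] at hfd
    have e1 : s ^ 2 / t + s = s * (s + t) / t := by field_simp
    have e2 : |s ^ 2 / t + s| * (s * t) = s ^ 2 * |s + t| := by
      rw [e1, abs_div, abs_mul]
      have : s * t = |s| * |t| := by rw [← abs_mul, abs_of_pos hst]
      rw [this, ← sq_abs s]
      have := abs_pos.2 ht
      field_simp
    rw [e2] at hfd
    have hs2' : 0 < s ^ 2 := by positivity
    have := mul_left_cancel₀ hs2'.ne' hfd
    have := congrArg (· ^ 2) this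
    simp only [sq_abs] at this
    nlinarith
  rcases lt_or_gt_of_ne ht with ht' | ht'
  · exact hkey (-r) (by linarith) (by nlinarith) (by rw [hminus, neg_neg])
      (by rw [abs_neg, abs_of_pos hr])
  · exact hkey r hr.ne' (by positivity) hplus (abs_of_pos hr)

/-- The spaces punctured at a point have inversions. -/
theorem inversiveSpace (hP : M.IsPtolemy) (hE : M.PropertyE) (hI : M.PropertyI)
    (hd : d ∈ M.metrics) (h : d.remote = some ω) :
    letI := d.metricSpace h
    InversiveSpace (Punctured X ω) := by
  classical
  have h3 := exists_three_points hE
  obtain ⟨c₀, hc₀⟩ := exists_line_punctured hP hE hI hd h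
  let := d.metricSpace h
  refine ⟨fun x y z w => hP.isPtolemaic hd x y z w, ⟨_, hc₀.isometry h⟩, fun o x hx => ?_⟩
  have hxo : x.1 ≠ o.1 := fun h => hx (Subtype.ext h)
  obtain ⟨φ, hφ, -⟩ := hI ω o o.2.symm _ (isSphere_of_ne x.2 hxo)
  obtain ⟨h0, hdist, hcenter⟩ := hφ.factor_eq hP hd h o.2 x.2 hxo
  have hval : ∀ {y z : Punctured X ω}, y ≠ z → y.1 ≠ z.1 := fun h h' => h (Subtype.ext h')
  have hφω : ∀ y : Punctured X ω, y ≠ o → φ y ≠ ω := fun y hy h' =>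
    hval hy (hφ.isAut.bijective.injective (h'.trans h0.symm))
  -- The default value is taken only at `o`, which `φ` sends to `ω`.
  let ψ : Punctured X ω → Punctured X ω := fun y => if hy : φ y = ω then y else ⟨φ y, hy⟩
  have hψ : ∀ y, y ≠ o → (ψ y).1 = φ y := fun y hy => by
    simp only [ψ]
    rw [dif_neg (hφω y hy)]
  have hψo : ∀ y, y ≠ o → ψ y ≠ o := fun y hy h' => by
    have h1 := hψ y hy
    rw [h', ← hφ.map_base] at h1
    exact y.2 (hφ.isAut.bijective.injective h1.symm)
  refine ⟨ψ, hψo, fun y hy => Subtype.ext ?_, fun y z hy hz => ?_, fun y hy => ?_,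
    fun c hc hc0 t ht => Subtype.ext ?_⟩
  · rw [hψ _ (hψo y hy), hψ y hy, hφ.involutive]
  · change d.factor (ψ y) (ψ z) = _
    rw [hψ y hy, hψ z hz]
    exact hdist y z y.2 z.2 (hval hy) (hval hz)
  · change d.factor (ψ y) o = _
    rw [hψ y hy]
    exact hcenter y y.2 (hval hy)
  · subst hc0
    rw [hψ _ fun h' => ht (hc.injective h')]
    exact IsSpaceInversion.isLine_apply hP h3 hd h (isLine_of_isometry h hc) x.2 hxo hφ ht

theorem isPtolemyLine_iff (hP : M.IsPtolemy) (hE : M.PropertyE) (hd : d ∈ M.metrics)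
    (h : d.remote = some ω) (l : Set (Punctured X ω)) :
    letI := d.metricSpace h
    M.IsPtolemyLine ω l ↔ ∃ c : ℝ → Punctured X ω, Isometry c ∧ l = Set.range c := by
  have h3 := exists_three_points hE
  let := d.metricSpace h
  constructor
  · rintro ⟨σ, hσ, hω, rfl⟩
    obtain ⟨c, hc, rfl⟩ := hσ.exists_isLine h3 hd h hω
    refine ⟨_, hc.isometry h, ?_⟩
    ext x
    constructor
    · rintro (hx | ⟨t, ht⟩)
      · exact absurd hx x.2
      · exact ⟨t, Subtype.ext ht⟩
    · rintro ⟨t, rfl⟩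
      exact Or.inr ⟨t, rfl⟩
  · rintro ⟨c, hc, rfl⟩
    refine ⟨_, isPtolemyCircle_of_isLine hP h3 hd h (isLine_of_isometry h hc), Or.inl rfl, ?_⟩
    ext x
    constructor
    · rintro ⟨t, rfl⟩
      exact Or.inr ⟨t, rfl⟩
    · rintro (hx | ⟨t, ht⟩)
      · exact absurd hx x.2
      · exact ⟨t, Subtype.ext ht⟩

theorem exists_base_punctured (hcompact : @CompactSpace X M.topology) (hP : M.IsPtolemy)
    (hE : M.PropertyE) (hI : M.PropertyI) (hd : d ∈ M.metrics) (h : d.remote = some ω) :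
    letI := d.metricSpace h
    ∃ (k : ℕ) (π : Punctured X ω → EuclideanSpace ℝ (Fin k)), 1 ≤ k ∧ Function.Surjective π ∧
      (∀ x y, IsGreatest {r | ∃ c, Isometry c ∧ r = busemann c x - busemann c y}
        (dist (π x) (π y))) ∧
      (∀ x y, π x ≠ π y → ∃ c, Isometry c ∧ c 0 = x ∧ π (c (dist (π x) (π y))) = π y) ∧
      ∀ b x, π x ≠ b → ∃! l : Set (Punctured X ω),
        M.IsPtolemyLine ω l ∧ x ∈ l ∧ (l ∩ π ⁻¹' {b}).Nonempty := by
  have h3 := exists_three_points hE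
  have hl := isPtolemyLine_iff hP hE hd h
  obtain ⟨c₀, hc₀⟩ := exists_line_punctured hP hE hI hd h
  let := d.metricSpace h
  have := inversiveSpace hP hE hI hd h
  have := properSpace h (topology_eq h3 hd ▸ hcompact)
  have : Nonempty (Punctured X ω) := ⟨⟨c₀ 0, hc₀.ne 0⟩⟩
  obtain ⟨k, π, hk, hs, hg, hline⟩ := exists_base (Y := Punctured X ω)
  refine ⟨k, π, hk, hs, hg, hline, fun b x hx => ?_⟩
  -- The base distance bounds all Busemann differences, so points of one fiber have equal Busemann
  -- values.
  have hbus : ∀ y z, π y = π z → ∀ e, Isometry e → busemann e y = busemann e z := by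
    have : ∀ y z, π y = π z → ∀ e, Isometry e → busemann e y ≤ busemann e z := by
      intro y z hyz e he
      have := (hg y z).2 ⟨e, he, rfl⟩
      rw [hyz, _root_.dist_self] at this
      linarith
    exact fun y z hyz e he => le_antisymm (this y z hyz e he) (this z y hyz.symm e he)
  obtain ⟨y, rfl⟩ := hs b
  obtain ⟨c, hc, h0, hcy⟩ := hline x y hx
  refine ⟨Set.range c, ⟨(hl _).2 ⟨c, hc, rfl⟩, ⟨0, h0⟩, _, ⟨_, rfl⟩, hcy⟩, ?_⟩
  rintro l ⟨hll, hxl, z, hzl, hzy⟩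
  obtain ⟨c', hc', rfl⟩ := (hl l).1 hll
  have hxz : x ≠ z := fun h' => hx (h' ▸ hzy)
  obtain ⟨c₁, hc₁, hr, h0', q, hq, hcq⟩ := exists_reparametrization hc' hxl hzl hxz
  have : c = c₁ := line_eq_of_busemannMap_eq hc hc₁ (h0.trans h0'.symm) (dist_pos.2 hx) hq
    (hbus _ _ (by rw [hcy, hcq]; exact Eq.symm hzy))
  rw [← hr, ← this]

end MoebiusStructure

end MoebiusGeometry

/-! ### Assembly of the theorem. -/

open MoebiusGeometry
theorem theorem2p5 {X : Type u} (M : MoebiusStructure X)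
    (hcompact : @CompactSpace X M.topology) (hPtolemy : M.IsPtolemy)
    (hE : M.PropertyE) (hI : M.PropertyI) :
    -- every point is infinitely remote for some metric of the structure
    (∀ ω : X, ∃ d ∈ M.metrics, d.remote = some ω) ∧
    -- and for every choice `d ω` of such metrics on the punctured spaces:
    ∀ d : X → ExtMetric X, (∀ ω, d ω ∈ M.metrics ∧ (d ω).remote = some ω) →
      ∃ (B : X → Type u) (_ : ∀ ω, MetricSpace (B ω)) (π : ∀ ω, Punctured X ω → B ω),
        (∀ ω, ∃ k : ℕ, 1 ≤ k ∧ Nonempty (B ω ≃ᵢ EuclideanSpace ℝ (Fin k))) ∧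
        (∀ ω, IsOneLipschitz (fun x y : Punctured X ω => (d ω).dist x y) (π ω) ∧
          IsSubmetry (fun x y : Punctured X ω => (d ω).dist x y) (π ω)) ∧
        (∀ (φ : X → X) (hφ : M.IsAut φ) (ω : X), ∃ φbar : B ω ≃ᵈ B (φ ω),
          ∀ x : Punctured X ω,
            π (φ ω) ⟨φ x, hφ.bijective.injective.ne x.2⟩ = φbar (π ω x)) ∧
        (∀ (ω : X) (b : B ω) (x : Punctured X ω), x ∉ π ω ⁻¹' {b} →
          ∃! l : Set (Punctured X ω),
            M.IsPtolemyLine ω l ∧ x ∈ l ∧ (l ∩ π ω ⁻¹' {b}).Nonempty) := by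
  refine ⟨MoebiusStructure.exists_remote hPtolemy, fun d hd => ?_⟩
  choose k π hk hs hg hline hK using fun ω =>
    MoebiusStructure.exists_base_punctured hcompact hPtolemy hE hI (hd ω).1 (hd ω).2
  have hlip : ∀ ω (x y : Punctured X ω), dist (π ω x) (π ω y) ≤ (d ω).factor x y := fun ω x y => by
    let := (d ω).metricSpace (hd ω).2
    obtain ⟨c, hc, h⟩ := (hg ω x y).1
    rw [h]
    exact busemann_sub_le hc x y
  have hfin : ∀ ω (x y : Punctured X ω), (d ω).dist x y ≠ ∞ := fun ω x y =>
    ExtMetric.dist_ne_top (ExtMetric.remote_ne_of_ne (hd ω).2 x.2)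
      (ExtMetric.remote_ne_of_ne (hd ω).2 y.2)
  -- `ULift` only places the Euclidean spaces in the universe of `X`.
  refine ⟨fun ω => ULift.{u} (EuclideanSpace ℝ (Fin (k ω))), fun ω => inferInstance,
    fun ω x => ⟨π ω x⟩, fun ω => ⟨k ω, hk ω, ⟨⟨Equiv.ulift, fun x y => rfl⟩⟩⟩, fun ω => ⟨?_, ?_⟩,
    fun φ hφ ω => ?_, fun ω b x hx => ?_⟩
  · intro x y
    change edist (π ω x) (π ω y) ≤ (d ω).dist x y
    rw [edist_dist, ← ExtMetric.ofReal_factor (hfin ω x y)]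
    exact ENNReal.ofReal_le_ofReal (hlip ω x y)
  · intro x r hr
    ext ⟨b⟩
    constructor
    · rintro ⟨y, hy, hyb⟩
      have hyb' : π ω y = b := congrArg ULift.down hyb
      subst hyb'
      change dist (π ω y) (π ω x) < r
      have hy' : (d ω).dist y x < ENNReal.ofReal r := hy
      rw [← ExtMetric.ofReal_factor (hfin ω y x), ENNReal.ofReal_lt_ofReal_iff hr] at hy'
      exact (hlip ω y x).trans_lt hy'
    · intro hb
      have hb' : dist b (π ω x) < r := hb
      obtain ⟨y, rfl⟩ := hs ω b
      by_cases hxy : π ω x = π ω y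
      · refine ⟨x, ?_, congrArg ULift.up hxy⟩
        change (d ω).dist x x < ENNReal.ofReal r
        rw [(d ω).dist_self]
        exact ENNReal.ofReal_pos.2 hr
      -- The line from `x` to the fiber of `y` reaches it at distance exactly the base distance,
      -- hence inside the ball.
      · obtain ⟨c, hc, h0, h1⟩ := hline ω x y hxy
        refine ⟨_, ?_, congrArg ULift.up h1⟩
        change (d ω).dist _ x < ENNReal.ofReal r
        rw [← ExtMetric.ofReal_factor (hfin ω _ x), ENNReal.ofReal_lt_ofReal_iff hr]
        let := (d ω).metricSpace (hd ω).2
        have h2 := hc.dist_eq (dist (π ω x) (π ω y)) 0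
        rw [h0, Real.dist_eq, sub_zero, abs_of_nonneg dist_nonneg, dist_comm (π ω x)] at h2
        rw [dist_comm (π ω x)]
        exact h2.trans_lt hb'
  · obtain ⟨l, hl, hsim⟩ := hφ.exists_similarity (hd ω).1 (hd (φ ω)).1 (hd ω).2 (hd (φ ω)).2
    let := (d ω).metricSpace (hd ω).2
    let := (d (φ ω)).metricSpace (hd (φ ω)).2
    have hsurj : Function.Surjective fun x : Punctured X ω =>
        (⟨φ x, hφ.bijective.injective.ne x.2⟩ : Punctured X (φ ω)) := by
      rintro ⟨y, hy⟩
      obtain ⟨x, rfl⟩ := hφ.bijective.surjective y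
      exact ⟨⟨x, fun h => hy (congrArg φ h)⟩, rfl⟩
    have hdist := dist_eq_of_similarity (hg ω) (hg (φ ω)) hsurj hl
      fun x y => hsim x y x.2 y.2
    exact exists_dilationEquiv (π := fun x => ULift.up.{u} (π ω x))
      (π' := fun x => ULift.up.{u} (π (φ ω) x)) (ULift.up_surjective.comp (hs ω))
      (ULift.up_surjective.comp (hs (φ ω))) hsurj hl hdist
  · obtain ⟨b⟩ := b
    have hx' : π ω x ≠ b := fun h => hx (congrArg ULift.up h)
    have heq : (fun x => ULift.up.{u} (π ω x)) ⁻¹' {ULift.up b} = π ω ⁻¹' {b} := by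
      ext y
      exact ULift.up_injective.eq_iff
    rw [heq]
    exact hK ω b x hx'
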